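/- Let $\alpha\ge 1$, let $n$ and $k$ be integers with $1<k<n-1$, and let $X_1,\dots,X_n$ be independent and identically distributed gamma random variables with shape parameter $\alpha$ and scale $1$. For a weight vector $w=(w_1,\dots,w_n)$ let $F_w(x)=\Pr\left(\sum_{i=1}^n w_iX_i\le x\right)$. Let $\theta=(\theta_1,\dots,\theta_n)$ satisfy $$0<\theta_1\le\cdots\le\theta_{k-1}<\theta_k\le\theta_{k+1}<\theta_{k+2}\le\cdots\le\theta_n .$$ For $\delta=(\delta_1,\dots,\delta_n)$ with all $\delta_i>0$ define $\eta=\eta(\delta)$ by $$\eta_i=\begin{cases}\theta_i+\delta_i, & 1\le i\le k-1,\\ \theta_k-\sum_{j=1}^{k-1}\delta_j, & i=k,\\ \theta_{k+1}+\sum_{j=k+2}^{n}\delta_j, & i=k+1,\\ \theta_i-\delta_i, & k+2\le i\le n.\end{cases}$$ Then there is $\varepsilon>0$, depending only on $\alpha,n,k$ and $\theta$, such that for every $\delta$ with all $\delta_i>0$ and $\sum_{i\ne k,k+1}\delta_i<\varepsilon$, the function $F_\eta$ crosses $F_\theta$ exactly once, and from below: there exists $x_0\in(0,\infty)$ such that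 $F_\eta(x)<F_\theta(x)$ for $0<x<x_0$ and $F_\eta(x)>F_\theta(x)$ for $x>x_0$. -/

import Mathlib

open MeasureTheory ProbabilityTheory Finset

/-- The law of `∑ i, θ i * X i`, where `X i` are iid gamma variables with shape `α` and scale `1`. -/
noncomputable def gammaSumLaw (α : ℝ) {n : ℕ} (θ : Fin n → ℝ) : Measure ℝ :=
  (Measure.pi (fun _ : Fin n => gammaMeasure α 1)).map (fun x => ∑ i, θ i * x i)

/-- The distribution function `F_θ` of `∑ i, θ i * X i`. -/
noncomputable def gammaSumCDF (α : ℝ) {n : ℕ} (θ : Fin n → ℝ) (x : ℝ) : ℝ :=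
  cdf (gammaSumLaw α θ) x

/-- `F` crosses `G` exactly once on `(0, ∞)`, and from below. -/
def CrossesExactlyOnceFromBelow (F G : ℝ → ℝ) : Prop :=
  ∃ x₀ : ℝ, 0 < x₀ ∧ (∀ x : ℝ, 0 < x → x < x₀ → F x < G x) ∧ (∀ x : ℝ, x₀ < x → G x < F x)

/-- The perturbed weight vector. The mathematical indices are `1, …, n`, so that `i : Fin n` stands
for the index `i + 1`; the index `k` is one of `1, …, n`. -/
noncomputable def localPerturbation {n : ℕ} (k : ℕ) (θ δ : Fin n → ℝ) (i : Fin n) : ℝ :=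
  if (i : ℕ) + 1 < k then θ i + δ i
  else if (i : ℕ) + 1 = k then θ i - ∑ j ∈ univ.filter (fun j : Fin n => (j : ℕ) + 1 < k), δ j
  else if (i : ℕ) + 1 = k + 1 then θ i + ∑ j ∈ univ.filter (fun j : Fin n => k + 1 < (j : ℕ) + 1), δ j
  else θ i - δ i

/-! Write `l i = 1 / θ i`. On the positive half-line the distribution function is the constant `1`
convolved with the gamma densities of rates `l i`. Its derivative in the weight `θ i` is `-α` times
the same convolution with `1` replaced by the exponential density `expo (l i)`. The perturbation
moves weight along vectors `e (u m) - e (v m)`: from index `k` to a lower index, or from a higher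
index to `k + 1`, so always `l (v m) < l (u m)`. Hence `F_θ - F_η` is, along the segment from `θ` to
`η`, an average with positive weights of the functions `genDiff (u m) (v m)`, which are convolutions
of `expo (l (u m)) - expo (l (v m))`. Each of these changes sign once, from `+` to `-`.

An average of such functions need not have a single zero. It does if, at the base point, every
nonnegative combination of any two of them has negative derivative at each positive zero. Indeed,
for each `z > 0` this pairwise condition yields one `μ` with `D' + μ D < 0` at `z` for all the
functions `D` at once (`exists_forall_add_mul_neg`). Then `exp (μ x) D x` is strictly decreasing
near `z`, stably in the weights, and averaging preserves this. Compactness covers an interval `[a,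
b]`; to its left all the functions are positive and to its right all are negative. This is where
smallness of the perturbation is used.

For the pairwise condition, a combination is factored as `expo b * W` with `W` crossing down. At a
zero its derivative is `b W`, and `W` is negative there. If the two generators share an index, one
gamma factor suffices, by monotonicity of a ratio (`conv_gen_same`). If one comes from each side
(`conv_gen_cross`), an algebraic identity brings both to the form `expo b * (h - expo a * h)`, where
`h` is built from a convolution `u` of two gamma densities. That `h'` crosses down reduces to sharp
bounds for a Riccati equation, that of a quotient of modified Bessel functions
(`Riccati.crossesDown`). The remaining gamma factors preserve the crossing property because their
densities are log-concave, which uses `α ≥ 1` (`CrossesDown.gam_mul`). -/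

/-! ### The Volterra convolution ring. -/

/-- Continuous functions on the line, to be multiplied by Volterra convolution. -/
def Volterra : Type := C(ℝ, ℝ)

namespace Volterra

noncomputable instance : AddCommGroup Volterra := inferInstanceAs (AddCommGroup C(ℝ, ℝ))
noncomputable instance : Module ℝ Volterra := inferInstanceAs (Module ℝ C(ℝ, ℝ))
instance : FunLike Volterra ℝ ℝ := inferInstanceAs (FunLike C(ℝ, ℝ) ℝ ℝ)

/-- The element with a given underlying continuous function. -/
def of (f : ℝ → ℝ) (hf : Continuous f) : Volterra := (⟨f, hf⟩ : C(ℝ, ℝ))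

@[simp] theorem of_apply (f : ℝ → ℝ) (hf : Continuous f) (x : ℝ) : of f hf x = f x := rfl

@[ext] theorem ext {f g : Volterra} (h : ∀ x, f x = g x) : f = g := DFunLike.ext f g h

@[fun_prop] theorem continuous (f : Volterra) : Continuous f := ContinuousMap.continuous (f : C(ℝ, ℝ))

@[simp] theorem add_apply (f g : Volterra) (x : ℝ) : (f + g) x = f x + g x := rfl
@[simp] theorem sub_apply (f g : Volterra) (x : ℝ) : (f - g) x = f x - g x := rfl
@[simp] theorem neg_apply (f : Volterra) (x : ℝ) : (-f) x = -f x := rfl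
@[simp] theorem zero_apply (x : ℝ) : (0 : Volterra) x = 0 := rfl
@[simp] theorem smul_apply (c : ℝ) (f : Volterra) (x : ℝ) : (c • f) x = c * f x := rfl

theorem continuous_conv {P : Type*} [TopologicalSpace P] {f g : P → ℝ → ℝ}
    (hf : Continuous fun q : P × ℝ => f q.1 q.2) (hg : Continuous fun q : P × ℝ => g q.1 q.2) :
    Continuous fun q : P × ℝ => ∫ t in (0 : ℝ)..q.2, f q.1 (q.2 - t) * g q.1 t := by
  refine intervalIntegral.continuous_parametric_intervalIntegral_of_continuous
    (f := fun (q : P × ℝ) t => f q.1 (q.2 - t) * g q.1 t) ?_ continuous_snd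
  refine Continuous.mul (hf.comp (f := fun r : (P × ℝ) × ℝ => (r.1.1, r.1.2 - r.2)) (by fun_prop))
    (hg.comp (f := fun r : (P × ℝ) × ℝ => (r.1.1, r.2)) (by fun_prop))

noncomputable instance : Mul Volterra :=
  ⟨fun f g => of (fun x => ∫ t in (0 : ℝ)..x, f (x - t) * g t) <| by
    have := continuous_conv (P := Unit) (f := fun _ => f) (g := fun _ => g)
      (by fun_prop) (by fun_prop)
    exact this.comp (f := fun x : ℝ => ((), x)) (by fun_prop)⟩

theorem mul_apply (f g : Volterra) (x : ℝ) : (f * g) x = ∫ t in (0 : ℝ)..x, f (x - t) * g t := rfl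

/-- Reflection in the origin. -/
def refl (f : Volterra) : Volterra := of (fun x => f (-x)) (by fun_prop)

@[simp] theorem refl_apply (f : Volterra) (x : ℝ) : refl f x = f (-x) := rfl

theorem refl_mul (f g : Volterra) (x : ℝ) : (f * g) (-x) = -(refl f * refl g) x := by
  rw [mul_apply, mul_apply]
  have := intervalIntegral.integral_comp_neg (a := (0 : ℝ)) (b := x)
    (fun t => f (-x - t) * g t)
  simp only [neg_zero] at this
  rw [intervalIntegral.integral_symm, ← this]
  congr 1
  refine intervalIntegral.integral_congr fun t _ => ?_
  simp only [refl_apply]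
  congr 2
  ring

theorem integral_triangle_swap {F : ℝ → ℝ → ℝ} (hF : Continuous fun q : ℝ × ℝ => F q.1 q.2)
    {x : ℝ} (hx : 0 ≤ x) :
    ∫ t in (0 : ℝ)..x, ∫ s in (0 : ℝ)..t, F s t = ∫ s in (0 : ℝ)..x, ∫ t in s..x, F s t := by
  have h1 : ∀ t ∈ Set.uIcc 0 x, ∫ s in (0 : ℝ)..t, F s t
      = ∫ s in (0 : ℝ)..x, (Set.Iic t).indicator (fun s => F s t) s := by
    intro t ht
    rw [Set.uIcc_of_le hx] at ht
    rw [intervalIntegral.integral_of_le hx, intervalIntegral.integral_of_le ht.1,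
      setIntegral_indicator measurableSet_Iic]
    congr 2
    ext s; simp only [Set.mem_Ioc, Set.mem_inter_iff, Set.mem_Iic]
    exact ⟨fun h => ⟨⟨h.1, h.2.trans ht.2⟩, h.2⟩, fun h => ⟨h.1.1, h.2⟩⟩
  have h2 : ∀ s ∈ Set.uIcc 0 x, ∫ t in s..x, F s t
      = ∫ t in (0 : ℝ)..x, (Set.Ici s).indicator (fun t => F s t) t := by
    intro s hs
    rw [Set.uIcc_of_le hx] at hs
    rw [intervalIntegral.integral_of_le hx, intervalIntegral.integral_of_le hs.2,
      ← integral_Icc_eq_integral_Ioc, ← integral_Icc_eq_integral_Ioc,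
      setIntegral_indicator measurableSet_Ici]
    congr 2
    ext t; simp only [Set.mem_Icc, Set.mem_inter_iff, Set.mem_Ici]
    exact ⟨fun h => ⟨⟨hs.1.trans h.1, h.2⟩, h.1⟩, fun h => ⟨h.2, h.1.2⟩⟩
  rw [intervalIntegral.integral_congr h1, intervalIntegral.integral_congr h2]
  have h3 : ∀ s t, (Set.Iic t).indicator (fun s => F s t) s
      = {q : ℝ × ℝ | q.1 ≤ q.2}.indicator (fun q => F q.1 q.2) (s, t) := by
    intro s t; simp [Set.indicator]
  have h4 : ∀ s t, (Set.Ici s).indicator (fun t => F s t) t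
      = {q : ℝ × ℝ | q.1 ≤ q.2}.indicator (fun q => F q.1 q.2) (s, t) := by
    intro s t; simp [Set.indicator]
  simp only [h3, h4]
  refine intervalIntegral_intervalIntegral_swap
    (F := fun t s => {q : ℝ × ℝ | q.1 ≤ q.2}.indicator (fun q => F q.1 q.2) (s, t)) ?_
  have hs : MeasurableSet {q : ℝ × ℝ | q.1 ≤ q.2} := measurableSet_le measurable_fst measurable_snd
  have h5 : IntegrableOn (fun q : ℝ × ℝ => F q.1 q.2) (Set.uIcc 0 x ×ˢ Set.uIcc 0 x) :=
    hF.continuousOn.integrableOn_compact (isCompact_uIcc.prod isCompact_uIcc)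
  have h6 : IntegrableOn ({q : ℝ × ℝ | q.1 ≤ q.2}.indicator fun q : ℝ × ℝ => F q.1 q.2)
      (Set.uIoc 0 x ×ˢ Set.uIoc 0 x) :=
    (h5.mono_set (Set.prod_mono Set.uIoc_subset_uIcc Set.uIoc_subset_uIcc)).indicator hs
  exact h6.swap

theorem mul_comm' (f g : Volterra) : f * g = g * f := by
  ext x
  rw [mul_apply, mul_apply]
  have := intervalIntegral.integral_comp_sub_left (a := (0 : ℝ)) (b := x)
    (fun t => g (x - t) * f t) x
  simp only [sub_self, sub_zero] at this
  rw [← this]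
  refine intervalIntegral.integral_congr fun t _ => ?_
  simp only [sub_sub_cancel]
  ring

theorem mul_assoc_nonneg (f g h : Volterra) {x : ℝ} (hx : 0 ≤ x) :
    (f * g * h) x = (f * (g * h)) x := by
  rw [mul_apply, mul_apply]
  have h1 : ∀ t, f (x - t) * (g * h) t = ∫ s in (0 : ℝ)..t, f (x - t) * g (t - s) * h s := by
    intro t
    rw [mul_apply, ← intervalIntegral.integral_const_mul]
    simp only [mul_assoc]
  simp only [h1]
  rw [integral_triangle_swap (F := fun s t => f (x - t) * g (t - s) * h s) (by fun_prop) hx]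
  refine intervalIntegral.integral_congr fun s _ => ?_
  simp only [mul_apply]
  rw [← intervalIntegral.integral_mul_const]
  have := intervalIntegral.integral_comp_sub_right (a := s) (b := x)
    (fun t => f (x - s - t) * g t * h s) s
  simp only [sub_self] at this
  rw [← this]
  refine intervalIntegral.integral_congr fun t _ => ?_
  simp only [sub_sub_sub_cancel_right]

theorem mul_assoc' (f g h : Volterra) : f * g * h = f * (g * h) := by
  ext x
  rcases le_total 0 x with hx | hx
  · exact mul_assoc_nonneg f g h hx
  -- Reflection in the origin turns the product into minus the product, so negative arguments follow
  -- from the nonnegative ones.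
  · obtain ⟨y, rfl⟩ : ∃ y, x = -y := ⟨-x, by ring⟩
    have hy : 0 ≤ y := by linarith
    have e (f g : Volterra) : refl (f * g) = -(refl f * refl g) := by
      ext z; rw [refl_apply, refl_mul]; rfl
    have n1 (f g : Volterra) : -f * g = -(f * g) := by
      ext z; simp [mul_apply, intervalIntegral.integral_neg]
    have n2 (f g : Volterra) : f * -g = -(f * g) := by
      ext z; simp [mul_apply, intervalIntegral.integral_neg]
    rw [refl_mul, refl_mul, e, e, n1, n2, neg_apply, neg_apply, mul_assoc_nonneg _ _ _ hy]

theorem add_mul' (f g h : Volterra) : (f + g) * h = f * h + g * h := by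
  ext x
  simp only [mul_apply, add_apply, add_mul]
  exact intervalIntegral.integral_add (Continuous.intervalIntegrable (by fun_prop) _ _)
    (Continuous.intervalIntegrable (by fun_prop) _ _)

noncomputable instance : NonUnitalCommRing Volterra :=
  { (inferInstance : AddCommGroup Volterra), (inferInstance : Mul Volterra) with
    left_distrib := fun f g h => by
      rw [mul_comm' f, add_mul', mul_comm' g, mul_comm' h]
    right_distrib := add_mul'
    zero_mul := fun f => by ext x; simp [mul_apply]
    mul_zero := fun f => by ext x; simp [mul_apply]
    mul_assoc := mul_assoc'
    mul_comm := mul_comm' }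

instance : IsScalarTower ℝ Volterra Volterra :=
  ⟨fun c f g => by
    ext x
    simp only [smul_eq_mul, mul_apply, smul_apply, mul_assoc]
    exact intervalIntegral.integral_const_mul _ _⟩

instance : SMulCommClass ℝ Volterra Volterra :=
  ⟨fun c f g => by
    simp only [smul_eq_mul]
    rw [mul_comm f, mul_comm f]
    exact (smul_assoc c g f).symm⟩

end Volterra

/-- Volterra convolution operators together with the identity. -/
abbrev VolterraUnit := Unitization ℝ Volterra

/-! ### Exponential and gamma densities. -/

namespace Volterra

/-- The constant function `1`. -/
def unitStep : Volterra := of (fun _ => 1) continuous_const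

@[simp] theorem unitStep_apply (x : ℝ) : unitStep x = 1 := rfl

/-- The exponential density with rate `l`. -/
noncomputable def expo (l : ℝ) : Volterra := of (fun x => l * Real.exp (-(l * x))) (by fun_prop)

theorem expo_apply (l x : ℝ) : expo l x = l * Real.exp (-(l * x)) := rfl

/-- The gamma density with shape `α` and rate `l`. -/
noncomputable def gam {α : ℝ} (hα : 1 ≤ α) (l : ℝ) : Volterra :=
  of (fun x => l ^ α / Real.Gamma α * x ^ (α - 1) * Real.exp (-(l * x))) <| by
    have : Continuous fun x : ℝ => x ^ (α - 1) := Real.continuous_rpow_const (by linarith)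
    fun_prop

theorem gam_apply {α : ℝ} (hα : 1 ≤ α) (l x : ℝ) :
    gam hα l x = l ^ α / Real.Gamma α * x ^ (α - 1) * Real.exp (-(l * x)) := rfl

theorem gam_pos {α : ℝ} (hα : 1 ≤ α) {l x : ℝ} (hl : 0 < l) (hx : 0 < x) : 0 < gam hα l x := by
  rw [gam_apply]
  have := Real.Gamma_pos_of_pos (show 0 < α by linarith)
  positivity

theorem gam_nonneg {α : ℝ} (hα : 1 ≤ α) {l x : ℝ} (hl : 0 < l) (hx : 0 ≤ x) :
    0 ≤ gam hα l x := by
  rw [gam_apply]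
  have := Real.Gamma_pos_of_pos (show 0 < α by linarith)
  positivity

theorem expo_pos {l : ℝ} (hl : 0 < l) (x : ℝ) : 0 < expo l x := by
  rw [expo_apply]; positivity

theorem mul_apply_zero (f g : Volterra) : (f * g) 0 = 0 := by simp [mul_apply]

theorem mul_apply' (f g : Volterra) (x : ℝ) : (f * g) x = ∫ t in (0 : ℝ)..x, f t * g (x - t) := by
  rw [mul_comm, mul_apply]
  exact intervalIntegral.integral_congr fun t _ => mul_comm _ _

theorem unitStep_mul_apply (g : Volterra) (x : ℝ) : (unitStep * g) x = ∫ t in (0 : ℝ)..x, g t := by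
  simp [mul_apply]

theorem hasDerivAt_unitStep_mul (g : Volterra) (x : ℝ) : HasDerivAt (unitStep * g) (g x) x := by
  have h : (fun x => ∫ t in (0 : ℝ)..x, g t) = (unitStep * g : Volterra) :=
    funext fun x => (unitStep_mul_apply g x).symm
  rw [← h]
  exact g.continuous.integral_hasStrictDerivAt 0 x |>.hasDerivAt

theorem expo_mul_apply (l : ℝ) (g : Volterra) (x : ℝ) :
    (expo l * g) x = l * Real.exp (-(l * x)) * ∫ t in (0 : ℝ)..x, Real.exp (l * t) * g t := by
  rw [mul_apply, ← intervalIntegral.integral_const_mul]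
  refine intervalIntegral.integral_congr fun t _ => ?_
  simp only [expo_apply]
  rw [show -(l * (x - t)) = -(l * x) + l * t by ring, Real.exp_add]
  ring

theorem hasDerivAt_expo_mul (l : ℝ) (g : Volterra) (x : ℝ) :
    HasDerivAt (expo l * g) (l * (g x - (expo l * g) x)) x := by
  have h : (expo l * g : Volterra) =
      fun x => l * Real.exp (-(l * x)) * ∫ t in (0 : ℝ)..x, Real.exp (l * t) * g t :=
    funext (expo_mul_apply l g)
  have h1 : HasDerivAt (fun x => ∫ t in (0 : ℝ)..x, Real.exp (l * t) * g t)
      (Real.exp (l * x) * g x) x :=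
    ((show Continuous fun t => Real.exp (l * t) * g t by fun_prop).integral_hasStrictDerivAt
      0 x).hasDerivAt
  have h2 : HasDerivAt (fun x => l * Real.exp (-(l * x))) (l * (Real.exp (-(l * x)) * -(l * 1))) x :=
    (((hasDerivAt_id x).const_mul l).neg.exp).const_mul l
  have h3 := h2.mul h1
  rw [expo_mul_apply, h]
  refine h3.congr_deriv ?_
  have : Real.exp (-(l * x)) * Real.exp (l * x) = 1 := by rw [← Real.exp_add]; simp
  linear_combination (l * g x) * this

/-- Partial fractions, or the resolvent identity: on Laplace transforms `expo l` is `l / (l + s)`.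
Without division it stays valid for `a = b`. -/
theorem expo_mul_expo (a b : ℝ) :
    (b - a) • (expo a * expo b) = b • expo a - a • expo b := by
  ext x
  simp only [smul_apply, sub_apply, expo_apply, expo_mul_apply]
  have h (t : ℝ) : HasDerivAt (fun t => -(b * Real.exp ((a - b) * t)))
      (-(b * (Real.exp ((a - b) * t) * ((a - b) * 1)))) t :=
    ((((hasDerivAt_id t).const_mul (a - b)).exp).const_mul b).neg
  have := intervalIntegral.integral_eq_sub_of_hasDerivAt (a := 0) (b := x) (fun t _ => h t)
    (Continuous.intervalIntegrable (by fun_prop) _ _)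
  have h2 : (b - a) * ∫ t in (0 : ℝ)..x, Real.exp (a * t) * (b * Real.exp (-(b * t)))
      = -(b * Real.exp ((a - b) * x)) - -(b * Real.exp ((a - b) * 0)) := by
    rw [← this, ← intervalIntegral.integral_const_mul]
    refine intervalIntegral.integral_congr fun t _ => ?_
    rw [show (a - b) * t = a * t + -(b * t) by ring, Real.exp_add]
    ring
  have h3 : Real.exp (-(a * x)) * Real.exp ((a - b) * x) = Real.exp (-(b * x)) := by
    rw [← Real.exp_add]; ring_nf
  simp only [mul_zero, Real.exp_zero] at h2
  linear_combination (a * Real.exp (-(a * x))) * h2 - a * b * h3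

theorem smul_unitStep_sub (l : ℝ) : l • (unitStep - expo l * unitStep) = expo l := by
  ext x
  have h (t : ℝ) : HasDerivAt (fun t => Real.exp (l * t)) (Real.exp (l * t) * (l * 1)) t :=
    ((hasDerivAt_id t).const_mul l).exp
  have := intervalIntegral.integral_eq_sub_of_hasDerivAt (a := 0) (b := x) (fun t _ => h t)
    (Continuous.intervalIntegrable (by fun_prop) _ _)
  simp only [smul_apply, sub_apply, expo_apply, expo_mul_apply, unitStep_apply, mul_one]
  rw [intervalIntegral.integral_mul_const] at this
  have h3 : Real.exp (-(l * x)) * Real.exp (l * x) = 1 := by rw [← Real.exp_add]; simp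
  simp only [mul_zero, Real.exp_zero, mul_one] at this
  linear_combination (-l * Real.exp (-(l * x))) * this - l * h3

/-- Both sides are multiples of the gamma density of shape `α + 1`. This turns multiplication by the
variable, and hence differentiation in the rate, into convolution. -/
theorem mul_gam_apply {α : ℝ} (hα : 1 ≤ α) (l x : ℝ) :
    l * (x * gam hα l x) = α * (gam hα l * expo l) x := by
  have h1 : x * x ^ (α - 1) = x ^ α := by
    rcases eq_or_ne x 0 with rfl | hx
    · rw [zero_mul, Real.zero_rpow (by linarith)]
    · rw [Real.rpow_sub_one hx]; field_simp
  have h2 : ∫ t in (0 : ℝ)..x, t ^ (α - 1) = x ^ α / α := by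
    rw [integral_rpow (Or.inl (by linarith)), Real.zero_rpow (by linarith)]
    simp
  have h3 : (gam hα l * expo l) x
      = (l ^ α / Real.Gamma α * l * Real.exp (-(l * x))) * ∫ t in (0 : ℝ)..x, t ^ (α - 1) := by
    rw [mul_apply', ← intervalIntegral.integral_const_mul]
    refine intervalIntegral.integral_congr fun t _ => ?_
    simp only [gam_apply, expo_apply]
    rw [show -(l * x) = -(l * t) + -(l * (x - t)) by ring, Real.exp_add]
    ring
  rw [h3, h2, gam_apply, ← h1]
  field_simp

theorem mul_pos_of_pos {f g : Volterra} {x : ℝ} (hx : 0 < x) (hf : ∀ t, 0 < t → 0 < f t)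
    (hg : ∀ t, 0 < t → t < x → 0 < g t) : 0 < (f * g) x := by
  rw [mul_apply]
  refine intervalIntegral.intervalIntegral_pos_of_pos_on
    (Continuous.intervalIntegrable (by fun_prop) _ _) (fun t ht => ?_) hx
  exact mul_pos (hf _ (by linarith [ht.2])) (hg _ ht.1 ht.2)

end Volterra

/-! ### Functions with a single downward sign change. -/

/-- `f` changes sign at most once on `(0, ∞)`, from `+` to `-`, and in the strict sense. -/
def CrossesDown (f : ℝ → ℝ) : Prop := ∀ ⦃x y : ℝ⦄, 0 < x → x < y → f x ≤ 0 → f y < 0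

namespace CrossesDown
open Volterra

theorem exists_cut {f : ℝ → ℝ} (hf : CrossesDown f) {x : ℝ} (hx : ∃ y, 0 < y ∧ y < x ∧ f y ≤ 0) :
    ∃ c, 0 ≤ c ∧ c < x ∧ (∀ y, 0 < y → y < c → 0 < f y) ∧ ∀ y, c < y → f y < 0 := by
  obtain ⟨y, hy0, hyx, hy⟩ := hx
  set S := {y | 0 < y ∧ f y ≤ 0} with hS
  have hb : BddBelow S := ⟨0, fun z hz => hz.1.le⟩
  have hne : S.Nonempty := ⟨y, hy0, hy⟩
  refine ⟨sInf S, le_csInf hne fun z hz => hz.1.le, (csInf_le hb ⟨hy0, hy⟩).trans_lt hyx,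
    fun z hz hzc => ?_, fun z hz => ?_⟩
  · by_contra h
    exact absurd (csInf_le hb (show z ∈ S from ⟨hz, not_lt.1 h⟩)) (not_le.2 hzc)
  · obtain ⟨w, hw, hwz⟩ := exists_lt_of_csInf_lt hne hz
    exact hf hw.1 hwz hw.2

/-- From a nonpositive value the function is negative immediately afterwards. A first return to zero
would be reached from below, so the derivative there could not be negative. -/
theorem of_hasDerivAt {f f' : ℝ → ℝ} (hd : ∀ x, 0 < x → HasDerivAt f (f' x) x)
    (h : ∀ x, 0 < x → f x = 0 → f' x < 0) : CrossesDown f := by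
  have hc : ContinuousOn f (Set.Ioi 0) := fun x hx => (hd x hx).continuousAt.continuousWithinAt
  have key : ∀ x, 0 < x → f x ≤ 0 → ∃ r > x, ∀ z ∈ Set.Ioo x r, f z < 0 := by
    intro x hx hfx
    rcases hfx.lt_or_eq with hlt | heq
    · have := (hd x hx).continuousAt.eventually_lt continuousAt_const hlt
      obtain ⟨r, hr, hr'⟩ := Metric.eventually_nhds_iff.1 this
      refine ⟨x + r, by linarith, fun z hz => hr' ?_⟩
      rw [Real.dist_eq, abs_lt]; constructor <;> linarith [hz.1, hz.2]
    · have h1 := (hd x hx).tendsto_slope.eventually (gt_mem_nhds (h x hx heq))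
      rw [eventually_nhdsWithin_iff] at h1
      obtain ⟨r, hr, hr'⟩ := Metric.eventually_nhds_iff.1 h1
      refine ⟨x + r, by linarith, fun z hz => ?_⟩
      have h2 := hr' (y := z) (by rw [Real.dist_eq, abs_lt]; constructor <;> linarith [hz.1, hz.2])
        (ne_of_gt hz.1)
      rw [slope_def_field, heq, sub_zero] at h2
      by_contra h3
      exact absurd h2 (not_lt.2 (div_nonneg (not_lt.1 h3) (by linarith [hz.1])))
  intro x y hx hxy hfx
  by_contra hy
  rw [not_lt] at hy
  obtain ⟨r, hrx, hr⟩ := key x hx hfx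
  set m := min ((x + r) / 2) y
  have hm : x < m := lt_min (by linarith) hxy
  have hmy : m ≤ y := min_le_right _ _
  have hmr : m < r := (min_le_left _ _).trans_lt (by linarith)
  have hfm : f m < 0 := hr m ⟨hm, hmr⟩
  set S := {z | z ∈ Set.Icc m y ∧ 0 ≤ f z}
  have hb : BddBelow S := ⟨m, fun z hz => hz.1.1⟩
  have hne : S.Nonempty := ⟨y, ⟨hmy, le_rfl⟩, hy⟩
  have hcI : ContinuousOn f (Set.Icc m y) := hc.mono fun z hz => lt_of_lt_of_le (hx.trans hm) hz.1
  have hcl : IsClosed S := by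
    have := hcI.preimage_isClosed_of_isClosed isClosed_Icc (isClosed_Ici (a := (0 : ℝ)))
    exact this
  have hs := hcl.csInf_mem hne hb
  set s := sInf S
  have hms : m < s := lt_of_le_of_ne hs.1.1 fun e => by
    have := hs.2; rw [← e] at this; linarith
  have hs0 : 0 < s := by linarith
  have hlt : ∀ z, m ≤ z → z < s → f z < 0 := fun z h1 h2 => by
    by_contra h3
    exact absurd (csInf_le hb (show z ∈ S from ⟨⟨h1, (h2.trans_le hs.1.2).le⟩, not_lt.1 h3⟩))
      (not_le.2 h2)
  have hfs : f s = 0 := by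
    refine le_antisymm ?_ hs.2
    have h1 : Filter.Tendsto f (nhdsWithin s (Set.Iio s)) (nhds (f s)) :=
      (hd s hs0).continuousAt.tendsto.mono_left nhdsWithin_le_nhds
    refine le_of_tendsto h1 ?_
    filter_upwards [Ioo_mem_nhdsLT hms] with z hz using (hlt z hz.1.le hz.2).le
  have h1 := (hd s hs0).tendsto_slope.eventually (gt_mem_nhds (h s hs0 hfs))
  have h2 : ∀ᶠ z in nhdsWithin s (Set.Iio s), slope f s z < 0 :=
    h1.filter_mono (nhdsWithin_mono _ fun z hz => ne_of_lt hz)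
  obtain ⟨z, hz1, hz2⟩ := (h2.and (Ioo_mem_nhdsLT hms)).exists
  rw [slope_def_field, hfs, sub_zero] at hz1
  exact absurd hz1 (not_lt.2 (div_nonneg_of_nonpos (hlt z hz2.1.le hz2.2).le (by linarith [hz2.2])))

/-- Total positivity of order two of the kernel `gam (x - t)`, equivalently log-concavity of the
density. The exponentials cancel, and the power is monotone because `α - 1 ≥ 0`. -/
theorem _root_.Volterra.gam_ratio {α : ℝ} (hα : 1 ≤ α) {l x y s t : ℝ} (hl : 0 < l) (hxy : x ≤ y)
    (hst : s ≤ t) (htx : t ≤ x) :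
    gam hα l (y - s) * gam hα l (x - t) ≤ gam hα l (y - t) * gam hα l (x - s) := by
  simp only [gam_apply]
  have h1 : ((y - s) * (x - t)) ^ (α - 1) ≤ ((y - t) * (x - s)) ^ (α - 1) := by
    refine Real.rpow_le_rpow (mul_nonneg (by linarith) (by linarith)) ?_ (by linarith)
    nlinarith
  rw [Real.mul_rpow (by linarith) (by linarith), Real.mul_rpow (by linarith) (by linarith)] at h1
  have h2 : Real.exp (-(l * (y - s))) * Real.exp (-(l * (x - t)))
      = Real.exp (-(l * (y - t))) * Real.exp (-(l * (x - s))) := by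
    rw [← Real.exp_add, ← Real.exp_add]; ring_nf
  have hG := Real.Gamma_pos_of_pos (show 0 < α by linarith)
  have hc : 0 ≤ (l ^ α / Real.Gamma α) ^ 2 *
      (Real.exp (-(l * (y - t))) * Real.exp (-(l * (x - s)))) := by positivity
  calc _ = (l ^ α / Real.Gamma α) ^ 2 * (Real.exp (-(l * (y - s))) * Real.exp (-(l * (x - t))))
        * ((y - s) ^ (α - 1) * (x - t) ^ (α - 1)) := by ring
    _ ≤ (l ^ α / Real.Gamma α) ^ 2 * (Real.exp (-(l * (y - t))) * Real.exp (-(l * (x - s))))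
        * ((y - t) ^ (α - 1) * (x - s) ^ (α - 1)) := by
        rw [h2]; exact mul_le_mul_of_nonneg_left h1 hc
    _ = _ := by ring

theorem exists_nonpos_of_mul {f g : Volterra} {x : ℝ} (hx : 0 < x) (hf : ∀ t, 0 < t → 0 < f t)
    (h : (f * g) x ≤ 0) : ∃ y, 0 < y ∧ y < x ∧ g y ≤ 0 := by
  by_contra hcon
  push Not at hcon
  exact absurd (mul_pos_of_pos hx hf hcon) (not_lt.2 h)

/-- Variation diminishing for one sign change. If `g` changes sign at `c`, then `gam_ratio` bounds
the kernel at `y` by that at `x`, normalized at `c`, with the right sign on each side of `c`. The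
extra mass on `(x, y)` is strictly negative. -/
theorem gam_mul {α : ℝ} (hα : 1 ≤ α) {l : ℝ} (hl : 0 < l) {g : Volterra} (hg : CrossesDown g) :
    CrossesDown (gam hα l * g : Volterra) := by
  intro x y hx hxy h
  obtain ⟨c, hc0, hcx, hpos, hneg⟩ :=
    hg.exists_cut (exists_nonpos_of_mul hx (fun t ht => gam_pos hα hl ht) h)
  have hγ : 0 < gam hα l (x - c) := gam_pos hα hl (by linarith)
  have h1 : ∫ t in (0 : ℝ)..x, gam hα l (x - c) * (gam hα l (y - t) * g t)
      ≤ ∫ t in (0 : ℝ)..x, gam hα l (y - c) * (gam hα l (x - t) * g t) := by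
    refine intervalIntegral.integral_mono_on hx.le (Continuous.intervalIntegrable (by fun_prop) _ _)
      (Continuous.intervalIntegrable (by fun_prop) _ _) fun t ht => ?_
    rcases lt_trichotomy t c with htc | rfl | htc
    · rcases ht.1.eq_or_lt with rfl | ht0
      -- The cut only controls positive arguments, so the value at the endpoint comes from
      -- continuity.
      · have h0 : 0 ≤ g 0 := by
          have h1 : Filter.Tendsto g (nhdsWithin 0 (Set.Ioi 0)) (nhds (g 0)) :=
            g.continuous.continuousAt.tendsto.mono_left nhdsWithin_le_nhds
          refine ge_of_tendsto h1 ?_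
          filter_upwards [Ioo_mem_nhdsGT htc] with z hz using (hpos z hz.1 hz.2).le
        have := mul_le_mul_of_nonneg_right (gam_ratio hα hl hxy.le htc.le hcx.le) h0
        linarith
      · have := mul_le_mul_of_nonneg_right (gam_ratio hα hl hxy.le htc.le hcx.le) (hpos t ht0 htc).le
        linarith
    · linarith
    · have := mul_le_mul_of_nonpos_right (gam_ratio hα hl hxy.le htc.le ht.2) (hneg t htc).le
      linarith
  rw [intervalIntegral.integral_const_mul, intervalIntegral.integral_const_mul, ← mul_apply] at h1
  have h2 : 0 < ∫ t in x..y, -(gam hα l (y - t) * g t) :=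
    intervalIntegral.intervalIntegral_pos_of_pos_on
      (Continuous.intervalIntegrable (by fun_prop) _ _)
      (fun t ht => by
        have := mul_neg_of_pos_of_neg (gam_pos hα hl (show 0 < y - t by linarith [ht.2]))
          (hneg t (by linarith [ht.1]))
        linarith) hxy
  rw [intervalIntegral.integral_neg] at h2
  have h3 := intervalIntegral.integral_add_adjacent_intervals (μ := volume)
    (f := fun t => gam hα l (y - t) * g t) (a := 0) (b := x) (c := y)
    (Continuous.intervalIntegrable (by fun_prop) _ _)
    (Continuous.intervalIntegrable (by fun_prop) _ _)
  rw [mul_apply, ← h3]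
  have h4 : gam hα l (y - c) * (gam hα l * g) x ≤ 0 :=
    mul_nonpos_of_nonneg_of_nonpos (gam_nonneg hα hl (by linarith)) h
  have h5 : ∫ t in (0 : ℝ)..x, gam hα l (y - t) * g t ≤ 0 := by
    by_contra h6
    have := mul_pos hγ (not_le.1 h6)
    linarith
  linarith

/-- At a zero of `expo l * g` the derivative is negative. -/
theorem neg_of_expo_mul_eq_zero {g : Volterra} (hg : CrossesDown g) {l x : ℝ} (hl : 0 < l)
    (hx : 0 < x) (h : (expo l * g) x = 0) : g x < 0 := by
  obtain ⟨y, hy0, hyx, hy⟩ := exists_nonpos_of_mul hx (fun t _ => expo_pos hl t) h.le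
  exact hg hy0 hyx hy

end CrossesDown

/-! ### Differential inequalities on the half-line. -/

/-- A function that is positive near `0` and whose logarithmic derivative is bounded below
wherever it is positive stays positive. -/
theorem pos_of_deriv_ge_neg_mul {φ φ' : ℝ → ℝ} (hd : ∀ x, 0 < x → HasDerivAt φ (φ' x) x)
    (h0 : ∀ r, 0 < r → ∃ x, 0 < x ∧ x < r ∧ 0 < φ x)
    (h : ∀ a b, 0 < a → a ≤ b → ∃ C, ∀ x ∈ Set.Icc a b, 0 < φ x → -C * φ x ≤ φ' x) :
    ∀ x, 0 < x → 0 < φ x := by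
  intro b hb
  by_contra hcon
  obtain ⟨a, ha, hab, hφa⟩ := h0 b hb
  obtain ⟨C, hC⟩ := h a b ha hab.le
  set S := {z | z ∈ Set.Icc a b ∧ φ z ≤ 0}
  have hbd : BddBelow S := ⟨a, fun z hz => hz.1.1⟩
  have hne : S.Nonempty := ⟨b, ⟨hab.le, le_rfl⟩, not_lt.1 hcon⟩
  have hc : ContinuousOn φ (Set.Icc a b) := fun x hx =>
    (hd x (ha.trans_le hx.1)).continuousAt.continuousWithinAt
  have hcl : IsClosed S := hc.preimage_isClosed_of_isClosed isClosed_Icc (isClosed_Iic (a := (0 : ℝ)))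
  have hs := hcl.csInf_mem hne hbd
  set s := sInf S
  have hpos : ∀ z, a ≤ z → z < s → 0 < φ z := fun z h1 h2 => by
    by_contra h3
    exact absurd (csInf_le hbd (show z ∈ S from ⟨⟨h1, (h2.trans_le hs.1.2).le⟩, not_lt.1 h3⟩))
      (not_le.2 h2)
  have hder : ∀ x, a ≤ x → HasDerivAt (fun x => Real.exp (C * x) * φ x)
      (Real.exp (C * x) * (C * 1) * φ x + Real.exp (C * x) * φ' x) x := fun x hx =>
    (((hasDerivAt_id x).const_mul C).exp).mul (hd x (ha.trans_le hx))
  have hmono : MonotoneOn (fun x => Real.exp (C * x) * φ x) (Set.Icc a s) := by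
    refine monotoneOn_of_deriv_nonneg (convex_Icc a s)
      (fun x hx => (hder x hx.1).continuousAt.continuousWithinAt)
      (fun x hx => ?_) (fun x hx => ?_)
    · rw [interior_Icc] at hx
      exact (hder x hx.1.le).differentiableAt.differentiableWithinAt
    · rw [interior_Icc] at hx
      rw [(hder x hx.1.le).deriv]
      have := hC x ⟨hx.1.le, hx.2.le.trans hs.1.2⟩ (hpos x hx.1.le hx.2)
      have h2 : 0 ≤ Real.exp (C * x) * (C * φ x + φ' x) :=
        mul_nonneg (Real.exp_pos _).le (by linarith)
      linarith
  have := hmono (Set.left_mem_Icc.2 hs.1.1) (Set.right_mem_Icc.2 hs.1.1) hs.1.1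
  simp only at this
  have h1 : 0 < Real.exp (C * a) * φ a := by positivity
  have h2 : Real.exp (C * s) * φ s ≤ 0 :=
    mul_nonpos_of_nonneg_of_nonpos (Real.exp_pos _).le hs.2
  linarith

/-- The function `-φ` crosses down. So if `φ b ≤ 0`, then `φ` is negative on all of `(0, b)` and
increases there from the limit `0`, a contradiction. -/
theorem pos_of_deriv_pos_of_nonpos {φ φ' : ℝ → ℝ} (hd : ∀ x, 0 < x → HasDerivAt φ (φ' x) x)
    (h0 : Filter.Tendsto φ (nhdsWithin 0 (Set.Ioi 0)) (nhds 0))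
    (h : ∀ x, 0 < x → φ x ≤ 0 → 0 < φ' x) : ∀ x, 0 < x → 0 < φ x := by
  intro b hb
  by_contra hcon
  have hcd : CrossesDown fun x => -φ x :=
    CrossesDown.of_hasDerivAt (fun x hx => (hd x hx).neg) fun x hx h1 => by
      have := h x hx (by linarith)
      linarith
  have hneg : ∀ x, 0 < x → x < b → φ x < 0 := fun x hx hxb => by
    by_contra h1
    have := hcd hx hxb (by linarith)
    linarith
  have hmono : StrictMonoOn φ (Set.Ioo 0 b) := by
    refine strictMonoOn_of_deriv_pos (convex_Ioo 0 b)
      (fun x hx => (hd x hx.1).continuousAt.continuousWithinAt) (fun x hx => ?_)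
    rw [interior_Ioo] at hx
    rw [(hd x hx.1).deriv]
    exact h x hx.1 (hneg x hx.1 hx.2).le
  have h1 : (0 : ℝ) ≤ φ (b / 2) := by
    refine le_of_tendsto h0 ?_
    filter_upwards [Ioo_mem_nhdsGT (half_pos hb)] with z hz
    exact (hmono ⟨hz.1, hz.2.trans (by linarith)⟩ ⟨half_pos hb, by linarith⟩ hz.2).le
  linarith [hneg (b / 2) (half_pos hb) (by linarith)]

/-! ### The Riccati equation of a quotient of modified Bessel functions. -/

namespace Riccati

variable {α q : ℝ} {τ : ℝ → ℝ}

/-- The quantity `q x² τ'` for a solution of `τ' = q (1 - τ²) - 2 α τ / x`. -/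
def slope (α q : ℝ) (τ : ℝ → ℝ) (x : ℝ) : ℝ := (q * x) ^ 2 * (1 - τ x ^ 2) - 2 * α * (q * x) * τ x

theorem hasDerivAt_slope
    (hd : ∀ x, 0 < x → HasDerivAt τ (q * (1 - τ x ^ 2) - 2 * α * τ x / x) x) {x : ℝ} (hx : 0 < x) :
    HasDerivAt (slope α q τ)
      (q * (2 * α * τ x - 2 * slope α q τ x * τ x) - 2 * (α - 1) * slope α q τ x / x) x := by
  have h1 := (((hasDerivAt_id x).const_mul q).pow 2).mul (((hd x hx).pow 2).const_sub 1)
  have h2 := (((hasDerivAt_id x).const_mul q).const_mul (2 * α)).mul (hd x hx)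
  refine (h1.sub h2).congr_deriv ?_
  simp only [slope, id, Pi.pow_apply]
  field_simp
  ring

theorem slope_pos (hα : 1 ≤ α) (hq : 0 < q)
    (hd : ∀ x, 0 < x → HasDerivAt τ (q * (1 - τ x ^ 2) - 2 * α * τ x / x) x)
    (h0 : ∀ x, 0 < x → 0 < τ x) (h1 : ∀ x, 0 < x → τ x ≤ q * x) :
    ∀ x, 0 < x → 0 < slope α q τ x := by
  have hτ : Filter.Tendsto τ (nhdsWithin 0 (Set.Ioi 0)) (nhds 0) := by
    have h2 : Filter.Tendsto (fun x => q * x) (nhdsWithin 0 (Set.Ioi 0)) (nhds 0) := by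
      have : Continuous fun x : ℝ => q * x := by fun_prop
      simpa using (this.tendsto 0).mono_left (nhdsWithin_le_nhds (s := Set.Ioi 0))
    refine squeeze_zero' ?_ ?_ h2
    · filter_upwards [self_mem_nhdsWithin] with x hx using (h0 x hx).le
    · filter_upwards [self_mem_nhdsWithin] with x hx using h1 x hx
  refine pos_of_deriv_pos_of_nonpos (fun x hx => hasDerivAt_slope hd hx) ?_ fun x hx hω => ?_
  · have hx : Filter.Tendsto (fun x : ℝ => x) (nhdsWithin 0 (Set.Ioi 0)) (nhds 0) :=
      nhdsWithin_le_nhds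
    have := (((hx.const_mul q).pow 2).mul ((hτ.pow 2).const_sub 1)).sub
      (((hx.const_mul q).const_mul (2 * α)).mul hτ)
    simp only [mul_zero, sub_zero, ne_eq, OfNat.ofNat_ne_zero, not_false_eq_true, zero_pow,
      zero_mul] at this
    refine this.congr fun x => ?_
    simp only [slope]
  · have hτx := h0 x hx
    have : 0 ≤ -(2 * (α - 1) * slope α q τ x / x) := by
      rw [← neg_div]
      refine div_nonneg ?_ hx.le
      nlinarith
    have h3 : 0 < q * (2 * α * τ x - 2 * slope α q τ x * τ x) := by
      refine mul_pos hq ?_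
      nlinarith [mul_pos (show 0 < α by linarith) hτx]
    linarith

theorem slope_lt (hα : 1 ≤ α) (hq : 0 < q)
    (hd : ∀ x, 0 < x → HasDerivAt τ (q * (1 - τ x ^ 2) - 2 * α * τ x / x) x)
    (h0 : ∀ x, 0 < x → 0 < τ x) (h1 : ∀ x, 0 < x → τ x ≤ q * x) :
    ∀ x, 0 < x → slope α q τ x < α := by
  suffices ∀ x, 0 < x → 0 < α - slope α q τ x from fun x hx => by linarith [this x hx]
  refine pos_of_deriv_ge_neg_mul (fun x hx => (hasDerivAt_slope hd hx).const_sub α)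
    (fun r hr => ?_) fun a b ha hab => ?_
  -- With `q x ≤ 1/2` the slope is at most `(q x)² ≤ 1/4`, which is below `α`.
  · refine ⟨min (r / 2) (1 / (2 * q)), lt_min (by linarith) (by positivity),
      (min_le_left _ _).trans_lt (by linarith), ?_⟩
    set x := min (r / 2) (1 / (2 * q))
    have hx : 0 < x := lt_min (by linarith) (by positivity)
    have hqx : q * x ≤ 1 / 2 := by
      calc q * x ≤ q * (1 / (2 * q)) := mul_le_mul_of_nonneg_left (min_le_right _ _) hq.le
        _ = 1 / 2 := by field_simp
    have : slope α q τ x ≤ (q * x) ^ 2 := by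
      unfold slope
      have h3 : 0 ≤ 2 * α * (q * x) * τ x := by have := h0 x hx; positivity
      nlinarith [sq_nonneg (q * x * τ x)]
    nlinarith [mul_pos hq hx]
  · refine ⟨2 * q * (q * b) + 2 * (α - 1) / a, fun x hx hpos => ?_⟩
    have hx0 : 0 < x := ha.trans_le hx.1
    -- Rewritten in terms of `α - slope`, the derivative is a bounded multiple of it plus the
    -- nonnegative term `2 (α - 1) α / x`.
    have e : -(q * (2 * α * τ x - 2 * slope α q τ x * τ x) - 2 * (α - 1) * slope α q τ x / x)
        = -(2 * q * τ x + 2 * (α - 1) / x) * (α - slope α q τ x) + 2 * (α - 1) * α / x := by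
      field_simp; ring
    rw [e]
    have h3 : 2 * (α - 1) / x ≤ 2 * (α - 1) / a :=
      div_le_div_of_nonneg_left (by linarith) ha hx.1
    have h4 : 2 * q * τ x ≤ 2 * q * (q * b) := by
      refine mul_le_mul_of_nonneg_left ((h1 x hx0).trans ?_) (by positivity)
      exact mul_le_mul_of_nonneg_left hx.2 hq.le
    have h5 : 0 ≤ 2 * (α - 1) * α / x := by
      refine div_nonneg (mul_nonneg (by linarith) (by linarith)) hx0.le
    nlinarith

theorem mul_one_sub_lt (hα : 1 ≤ α) (hq : 0 < q)
    (hd : ∀ x, 0 < x → HasDerivAt τ (q * (1 - τ x ^ 2) - 2 * α * τ x / x) x)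
    (h0 : ∀ x, 0 < x → 0 < τ x) (h1 : ∀ x, 0 < x → τ x ≤ q * x) :
    ∀ x, 0 < x → q * x * (1 - τ x) < α := by
  suffices ∀ x, 0 < x → 0 < α - q * x * (1 - τ x) from fun x hx => by linarith [this x hx]
  have hder (x : ℝ) (hx : 0 < x) : HasDerivAt (fun x => α - q * x * (1 - τ x))
      (-(q * (1 - τ x) + q * x * -(q * (1 - τ x ^ 2) - 2 * α * τ x / x))) x := by
    have := (((hasDerivAt_id x).const_mul q).mul ((hd x hx).const_sub 1)).const_sub α
    refine this.congr_deriv ?_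
    simp only [id]; ring
  refine pos_of_deriv_ge_neg_mul hder (fun r hr => ?_) fun a b ha hab => ?_
  · refine ⟨min (r / 2) (1 / (2 * q)), lt_min (by linarith) (by positivity),
      (min_le_left _ _).trans_lt (by linarith), ?_⟩
    set x := min (r / 2) (1 / (2 * q))
    have hx : 0 < x := lt_min (by linarith) (by positivity)
    have hqx : q * x ≤ 1 / 2 := by
      calc q * x ≤ q * (1 / (2 * q)) := mul_le_mul_of_nonneg_left (min_le_right _ _) hq.le
        _ = 1 / 2 := by field_simp
    have := mul_pos (mul_pos hq hx) (h0 x hx)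
    nlinarith
  · refine ⟨2 * q + (q * b * (q * b) + α) / a, fun x hx hpos => ?_⟩
    have hx0 : 0 < x := ha.trans_le hx.1
    set β := α - q * x * (1 - τ x) with hβ
    have e : -(q * (1 - τ x) + q * x * -(q * (1 - τ x ^ 2) - 2 * α * τ x / x))
        = -(2 * q + β / x) * β + (β + α * (α - 1)) / x := by
      rw [hβ]; field_simp; ring
    rw [e]
    have h3 : 0 ≤ (β + α * (α - 1)) / x := by
      refine div_nonneg (add_nonneg hpos.le (mul_nonneg (by linarith) (by linarith))) hx0.le
    have h4 : β ≤ q * b * (q * b) + α := by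
      have h5 : q * x * τ x ≤ q * b * (q * b) := by
        have h6 : q * x ≤ q * b := mul_le_mul_of_nonneg_left hx.2 hq.le
        exact mul_le_mul h6 ((h1 x hx0).trans h6) (h0 x hx0).le (by nlinarith)
      nlinarith [mul_pos hq hx0]
    have h5 : β / x ≤ (q * b * (q * b) + α) / a :=
      div_le_div₀ (hpos.le.trans h4) h4 ha hx.1
    nlinarith

/-- The three brackets that control the second derivative. -/
theorem exists_shift {w t s : ℝ} (hα : 1 ≤ α) (hw : 0 < w) (hwα : w < α) (ht : 0 < t) (ht1 : t < 1)
    (hs : s < Real.sqrt w * (1 - t)) (hs0 : 0 < s) :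
    ∃ k, (1 - k) ^ 2 < 2 * α - 1 - w ∧ k ^ 2 < 2 * α - w ∧ (k * t + s) ^ 2 < w := by
  have hr : 0 < Real.sqrt w := Real.sqrt_pos.2 hw
  have hr2 : Real.sqrt w ^ 2 = w := Real.sq_sqrt hw.le
  set r := Real.sqrt w
  -- The shift is `k = min (√w) 1`. The third bracket bounds `k` from above by roughly `√w`, the
  -- first wants it near `1`.
  rcases lt_or_ge r 1 with h | h
  · refine ⟨r, by nlinarith, by nlinarith, ?_⟩
    rw [← hr2]
    exact pow_lt_pow_left₀ (by nlinarith) (by positivity) two_ne_zero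
  · have : 1 ≤ w := by nlinarith
    refine ⟨1, by nlinarith, by nlinarith, ?_⟩
    rw [← hr2]
    exact pow_lt_pow_left₀ (by nlinarith) (by positivity) two_ne_zero

/-- In the application this function is `x h' / u` for a nonnegative combination `h` of `u`, `x u`
and `v`. At a zero its derivative is made negative by completing a square and bounding what remains
with `exists_shift`. -/
theorem crossesDown (hα : 1 ≤ α) (hq : 0 < q)
    (hd : ∀ x, 0 < x → HasDerivAt τ (q * (1 - τ x ^ 2) - 2 * α * τ x / x) x)
    (h0 : ∀ x, 0 < x → 0 < τ x) (h1 : ∀ x, 0 < x → τ x ≤ q * x) (p : ℝ) {c₁ c₂ c₃ : ℝ}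
    (hc₁ : 0 ≤ c₁) (hc₂ : 0 ≤ c₂) (hc₃ : 0 ≤ c₃) (hc : 0 < c₁ + c₂ + c₃) :
    CrossesDown fun x => c₁ * (2 * α - 1 + q * x * τ x - p * x)
      + c₂ * (x * (2 * α + q * x * τ x - p * x)) + c₃ * (x * (q * x - p * x * τ x)) := by
  have hder (x : ℝ) (hx : 0 < x) :
      HasDerivAt (fun x => c₁ * (2 * α - 1 + q * x * τ x - p * x)
      + c₂ * (x * (2 * α + q * x * τ x - p * x)) + c₃ * (x * (q * x - p * x * τ x)))
      (c₁ * (q * τ x + q * x * (q * (1 - τ x ^ 2) - 2 * α * τ x / x) - p)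
       + c₂ * ((2 * α + q * x * τ x - p * x)
          + x * (q * τ x + q * x * (q * (1 - τ x ^ 2) - 2 * α * τ x / x) - p))
       + c₃ * ((q * x - p * x * τ x)
          + x * (q - (p * τ x + p * x * (q * (1 - τ x ^ 2) - 2 * α * τ x / x))))) x := by
    have i := hasDerivAt_id x
    have a1 := (i.const_mul q).mul (hd x hx)
    have a2 := (i.const_mul p).mul (hd x hx)
    have b1 := ((a1.const_add (2 * α - 1)).sub (i.const_mul p)).const_mul c₁
    have b2 := (i.mul ((a1.const_add (2 * α)).sub (i.const_mul p))).const_mul c₂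
    have b3 := (i.mul ((i.const_mul q).sub a2)).const_mul c₃
    refine ((b1.add b2).add b3).congr_deriv ?_
    simp only [id, Pi.mul_apply, Pi.sub_apply]
    ring
  refine CrossesDown.of_hasDerivAt hder fun x hx hzero => ?_
  have ht := h0 x hx
  have hw := slope_pos hα hq hd h0 h1 x hx
  have hwα := slope_lt hα hq hd h0 h1 x hx
  have hβ := mul_one_sub_lt hα hq hd h0 h1 x hx
  set t := τ x
  set w := slope α q τ x with hwdef
  have hw' : w = (q * x) ^ 2 * (1 - t ^ 2) - 2 * α * (q * x) * t := rfl
  have hqx : 0 < q * x := mul_pos hq hx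
  set s := w / (q * x) with hs
  have hsw : s * (q * x) = w := by rw [hs]; field_simp
  have hs0 : 0 < s := div_pos hw hqx
  have ht1 : t < 1 := by
    by_contra h
    have : (q * x) ^ 2 * (1 - t ^ 2) ≤ 0 :=
      mul_nonpos_of_nonneg_of_nonpos (by positivity) (by nlinarith)
    have : 0 < 2 * α * (q * x) * t := by positivity
    linarith
  -- Equivalent to `w < (q x)² (1 - t)²`, and by the definition of `w` this is the bound `q x (1 -
  -- t) < α`.
  have hslt : s < Real.sqrt w * (1 - t) := by
    rw [← Real.sqrt_sq (show 0 ≤ 1 - t by linarith), ← Real.sqrt_mul hw.le]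
    refine Real.lt_sqrt_of_sq_lt ?_
    have e1 : w < (q * x) ^ 2 * (1 - t) ^ 2 := by
      have : (q * x) * t * (q * x * (1 - t)) < (q * x) * t * α :=
        mul_lt_mul_of_pos_left hβ (by positivity)
      nlinarith
    have e2 : s ^ 2 * (q * x) ^ 2 = w * w := by rw [← hsw]; ring
    have e3 : s ^ 2 * (q * x) ^ 2 < w * (1 - t) ^ 2 * (q * x) ^ 2 := by
      rw [e2]; nlinarith
    exact lt_of_mul_lt_mul_right e3 (by positivity)
  obtain ⟨k, k1, k2, k3⟩ := exists_shift hα hw hwα ht ht1 hslt hs0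
  have hσ : x * (q * (1 - t ^ 2) - 2 * α * t / x) = s := by
    have : x * (q * (1 - t ^ 2) - 2 * α * t / x) = q * x * (1 - t ^ 2) - 2 * α * t := by
      field_simp
    rw [this]
    apply mul_right_cancel₀ hqx.ne'
    rw [hsw, hw']; ring
  set ρ := q * (1 - t ^ 2) - 2 * α * t / x
  set L := 2 * α - 1 + q * x * t - p * x with hL
  -- The last summand is a multiple of the function itself, so it vanishes at a zero. The first is
  -- minus a square, shifted by the free parameter `k`, and the other three are the brackets of
  -- `exists_shift`.
  have main : x * t * (c₁ * (q * t + q * x * ρ - p)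
       + c₂ * ((2 * α + q * x * t - p * x) + x * (q * t + q * x * ρ - p))
       + c₃ * ((q * x - p * x * t) + x * (q - (p * t + p * x * ρ))))
      = - (L + 1 - k) ^ 2 * (c₁ + c₂ * x + c₃ * (x * t)) * t
        + c₁ * t * ((1 - k) ^ 2 - (2 * α - 1 - w)) + c₂ * x * t * (k ^ 2 - (2 * α - w))
        + c₃ * x * ((k * t + s) ^ 2 - w)
        + t * (L + 3 - 2 * k) * (c₁ * L + c₂ * (x * (2 * α + q * x * t - p * x))
          + c₃ * (x * (q * x - p * x * t))) := by
    have hσ2 : x * ρ = s := hσ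
    have hs3 : s = q * x * (1 - t ^ 2) - 2 * α * t := by
      rw [← hσ2]; simp only [ρ]; field_simp
    have e4 : x * t * (c₁ * (q * t + q * x * ρ - p)
       + c₂ * ((2 * α + q * x * t - p * x) + x * (q * t + q * x * ρ - p))
       + c₃ * ((q * x - p * x * t) + x * (q - (p * t + p * x * ρ))))
       = t * (c₁ * (q * x * t + q * x * (x * ρ) - p * x)
       + c₂ * x * ((2 * α + q * x * t - p * x) + (q * x * t + q * x * (x * ρ) - p * x))
       + c₃ * x * ((q * x - p * x * t) + (q * x - (p * x * t + p * x * (x * ρ))))) := by ring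
    rw [e4, hσ2, ← hsw, hs3, hL]
    ring
  have hz : c₁ * L + c₂ * (x * (2 * α + q * x * t - p * x))
          + c₃ * (x * (q * x - p * x * t)) = 0 := hzero
  rw [hz, mul_zero, add_zero] at main
  have hxt : 0 < x * t := by positivity
  have g0 : - (L + 1 - k) ^ 2 * (c₁ + c₂ * x + c₃ * (x * t)) * t ≤ 0 := by
    have : 0 ≤ (L + 1 - k) ^ 2 * (c₁ + c₂ * x + c₃ * (x * t)) * t := by positivity
    linarith
  have g1 : c₁ * t * ((1 - k) ^ 2 - (2 * α - 1 - w)) ≤ 0 :=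
    mul_nonpos_of_nonneg_of_nonpos (by positivity) (by linarith)
  have g2 : c₂ * x * t * (k ^ 2 - (2 * α - w)) ≤ 0 :=
    mul_nonpos_of_nonneg_of_nonpos (by positivity) (by linarith)
  have g3 : c₃ * x * ((k * t + s) ^ 2 - w) ≤ 0 :=
    mul_nonpos_of_nonneg_of_nonpos (by positivity) (by linarith)
  have hlt : c₁ * t * ((1 - k) ^ 2 - (2 * α - 1 - w)) + c₂ * x * t * (k ^ 2 - (2 * α - w))
      + c₃ * x * ((k * t + s) ^ 2 - w) < 0 := by
    rcases hc₁.lt_or_eq with h | h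
    · have := mul_neg_of_pos_of_neg (mul_pos h ht) (sub_neg.2 k1)
      linarith
    rcases hc₂.lt_or_eq with h' | h'
    · have := mul_neg_of_pos_of_neg (mul_pos (mul_pos h' hx) ht) (sub_neg.2 k2)
      linarith
    have h'' : 0 < c₃ := by linarith
    have := mul_neg_of_pos_of_neg (mul_pos h'' hx) (sub_neg.2 k3)
    linarith
  by_contra hcon
  have := mul_nonneg hxt.le (not_lt.1 hcon)
  rw [main] at this
  linarith

end Riccati

theorem CrossesDown.of_pos_mul {f g : ℝ → ℝ} (hf : CrossesDown f) {w : ℝ → ℝ}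
    (hw : ∀ x, 0 < x → 0 < w x) (h : ∀ x, 0 < x → g x = w x * f x) : CrossesDown g := by
  intro x y hx hxy hg
  have hy := hx.trans hxy
  rw [h x hx] at hg
  rw [h y hy]
  refine mul_neg_of_pos_of_neg (hw y hy) (hf hx hxy ?_)
  by_contra hcon
  exact absurd (mul_pos (hw x hx) (not_le.1 hcon)) (not_lt.2 hg)

/-! ### Convolution of two gamma densities. -/

namespace Volterra

/-- Multiplication by the variable. -/
def mulX (f : Volterra) : Volterra := of (fun x => x * f x) (by fun_prop)

@[simp] theorem mulX_apply (f : Volterra) (x : ℝ) : mulX f x = x * f x := rfl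

theorem mulX_mul (f g : Volterra) : mulX (f * g) = mulX f * g + f * mulX g := by
  ext x
  simp only [mulX_apply, add_apply, mul_apply]
  rw [← intervalIntegral.integral_add (Continuous.intervalIntegrable (by fun_prop) _ _)
    (Continuous.intervalIntegrable (by fun_prop) _ _), ← intervalIntegral.integral_const_mul]
  exact intervalIntegral.integral_congr fun t _ => by ring

theorem smul_mulX_gam {α : ℝ} (hα : 1 ≤ α) (l : ℝ) :
    l • mulX (gam hα l) = α • (gam hα l * expo l) := by
  ext x; exact mul_gam_apply hα l x

/-- Multiplication by the variable is a derivation of convolution, and `mul_gam_apply` evaluates it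
on each factor. -/
theorem mul_mul_gam_mul_gam {α : ℝ} (hα : 1 ≤ α) (c d x : ℝ) :
    c * d * (x * (gam hα c * gam hα d) x) = α * (d * (expo c * (gam hα c * gam hα d)) x
      + c * (expo d * (gam hα c * gam hα d)) x) := by
  have h : (c * d) • mulX (gam hα c * gam hα d) = α • (d • (expo c * (gam hα c * gam hα d))
      + c • (expo d * (gam hα c * gam hα d))) := by
    have e1 : expo c * (gam hα c * gam hα d) = (gam hα c * expo c) * gam hα d := by
      rw [← mul_assoc, mul_comm (expo c)]
    have e2 : expo d * (gam hα c * gam hα d) = gam hα c * (gam hα d * expo d) := by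
      rw [mul_comm, mul_assoc]
    have e3 : (c * d) • (mulX (gam hα c) * gam hα d + gam hα c * mulX (gam hα d))
        = d • ((c • mulX (gam hα c)) * gam hα d) + c • (gam hα c * (d • mulX (gam hα d))) := by
      rw [smul_add, smul_mul_assoc, mul_smul_comm, smul_smul, smul_smul, mul_comm d c]
    rw [mulX_mul, e1, e2, e3, smul_mulX_gam, smul_mulX_gam, smul_add, smul_mul_assoc,
      mul_smul_comm, smul_comm d α, smul_comm c α]
  exact DFunLike.congr_fun h x

/-- With `g = h - expo l * h` one has `g' + l g = h'`. Thus `exp (l x) g` starts at `0`, and once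
`h'` has turned negative it decreases. -/
theorem crossesDown_sub_expo_mul {h : Volterra} {h' : ℝ → ℝ} (h0 : h 0 = 0)
    (hd : ∀ x, 0 < x → HasDerivAt h (h' x) x) (hc : CrossesDown h') (l : ℝ) :
    CrossesDown (h - expo l * h : Volterra) := by
  set g : Volterra := h - expo l * h with hg
  have hder (x : ℝ) (hx : 0 < x) : HasDerivAt (fun x => Real.exp (l * x) * g x)
      (Real.exp (l * x) * h' x) x := by
    have h1 := (((hasDerivAt_id x).const_mul l).exp).mul ((hd x hx).sub (hasDerivAt_expo_mul l h x))
    refine h1.congr_deriv ?_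
    simp only [id, Pi.sub_apply]
    ring
  have hcont : Continuous fun x => Real.exp (l * x) * g x := by fun_prop
  intro x y hx hxy hgx
  have hex : ∃ z, 0 < z ∧ z < x ∧ h' z ≤ 0 := by
    by_contra hcon
    push Not at hcon
    have hm : StrictMonoOn (fun x => Real.exp (l * x) * g x) (Set.Icc 0 x) := by
      refine strictMonoOn_of_deriv_pos (convex_Icc 0 x) hcont.continuousOn fun z hz => ?_
      rw [interior_Icc] at hz
      rw [(hder z hz.1).deriv]
      exact mul_pos (Real.exp_pos _) (hcon z hz.1 hz.2)
    have h1 := hm (Set.left_mem_Icc.2 hx.le) (Set.right_mem_Icc.2 hx.le) hx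
    have h2 : g 0 = 0 := by rw [hg, sub_apply, h0, mul_apply_zero, sub_zero]
    simp only [h2, mul_zero] at h1
    exact absurd (pos_of_mul_pos_right h1 (Real.exp_pos _).le) (not_lt.2 hgx)
  obtain ⟨z, hz0, hzx, hz⟩ := hex
  have hm : StrictAntiOn (fun x => Real.exp (l * x) * g x) (Set.Icc x y) := by
    refine strictAntiOn_of_deriv_neg (convex_Icc x y) hcont.continuousOn fun w hw => ?_
    rw [interior_Icc] at hw
    rw [(hder w (hx.trans hw.1)).deriv]
    exact mul_neg_of_pos_of_neg (Real.exp_pos _) (hc hz0 (hzx.trans hw.1) hz)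
  have h1 := hm (Set.left_mem_Icc.2 hxy.le) (Set.right_mem_Icc.2 hxy.le) hxy
  have h2 : Real.exp (l * x) * g x ≤ 0 := mul_nonpos_of_nonneg_of_nonpos (Real.exp_pos _).le hgx
  simp only at h1
  by_contra h3
  have := mul_nonneg (Real.exp_pos (l * y)).le (not_lt.1 h3)
  linarith

/-- The middle combination `d • (expo c * u) + c • (expo d * u)` is a multiple of `x u`. The
derivative is then `u / x` times the function treated in `Riccati.crossesDown`. -/
theorem exists_hasDerivAt_crossesDown {α : ℝ} (hα : 1 ≤ α) {c d : ℝ} (hd : 0 < d) (hdc : d < c)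
    {k₁ k₂ k₃ : ℝ} (hk₁ : 0 ≤ k₁) (hk₂ : 0 ≤ k₂) (hk₃ : 0 ≤ k₃) (hk : 0 < k₁ + k₂ + k₃)
    {u : Volterra} (hu : u = gam hα c * gam hα d) :
    ∃ h' : ℝ → ℝ, (∀ x, 0 < x → HasDerivAt (k₁ • u + k₂ • (d • (expo c * u) + c • (expo d * u))
      + k₃ • (expo c * (expo d * u)) : Volterra) (h' x) x) ∧ CrossesDown h' := by
  have hc : 0 < c := hd.trans hdc
  have hα0 : 0 < α := by linarith
  set E := expo c * u with hE
  set F := expo d * u with hF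
  set v := expo c * F with hv
  have r1 (x : ℝ) : c * d * (x * u x) = α * (d * E x + c * F x) := by
    rw [hE, hF, hu]; exact mul_mul_gam_mul_gam hα c d x
  have r2 (x : ℝ) : (d - c) * v x = d * E x - c * F x := by
    have h : (d - c) • v = d • E - c • F := by
      rw [hv, hE, hF, ← mul_assoc, ← smul_mul_assoc, expo_mul_expo, sub_mul, smul_mul_assoc,
        smul_mul_assoc]
    exact DFunLike.congr_fun h x
  have dE (x : ℝ) : HasDerivAt E (c * (u x - E x)) x := hasDerivAt_expo_mul c u x
  have dF (x : ℝ) : HasDerivAt F (d * (u x - F x)) x := hasDerivAt_expo_mul d u x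
  have dv (x : ℝ) : HasDerivAt v (c * (F x - v x)) x := hasDerivAt_expo_mul c F x
  have hupos (x : ℝ) (hx : 0 < x) : 0 < u x := by
    rw [hu]
    exact mul_pos_of_pos hx (fun t ht => gam_pos hα hc ht) fun t ht _ => gam_pos hα hd ht
  have hFpos (x : ℝ) (hx : 0 < x) : 0 < F x :=
    mul_pos_of_pos hx (fun t _ => expo_pos hd t) fun t ht _ => hupos t ht
  have hvpos (x : ℝ) (hx : 0 < x) : 0 < v x :=
    mul_pos_of_pos hx (fun t _ => expo_pos hc t) fun t ht _ => hFpos t ht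
  have eF (x : ℝ) : F x = (c * d * x * u x / α + (c - d) * v x) / (2 * c) := by
    field_simp
    linear_combination (-1 : ℝ) * r1 x + α * r2 x
  have eE (x : ℝ) : E x = (c * d * x * u x / α - (c - d) * v x) / (2 * d) := by
    field_simp
    linear_combination (-1 : ℝ) * r1 x - α * r2 x
  set p := (c + d) / 2 with hp
  set q := (c - d) / 2 with hq
  have hq0 : 0 < q := by rw [hq]; linarith
  set m := 2 * α * q / (c * d) with hm
  have hm0 : 0 < m := by positivity
  have du (x : ℝ) (hx : 0 < x) :
      HasDerivAt u (((2 * α - 1) * u x + q * m * v x) / x - p * u x) x := by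
    -- The derivative of `u` is read off from `r1`: for `x > 0` it expresses `u` through `E` and
    -- `F`, whose derivatives are known.
    have e : (fun x => α * (d * E x + c * F x) / (c * d) / x) =ᶠ[nhds x] u := by
      filter_upwards [lt_mem_nhds hx] with y hy
      rw [← r1 y]; field_simp
    have h1 := (((((dE x).const_mul d).add ((dF x).const_mul c)).const_mul α).div_const
      (c * d)).div (hasDerivAt_id x) hx.ne'
    refine (h1.congr_of_eventuallyEq e.symm).congr_deriv ?_
    simp only [Pi.add_apply, id]
    rw [eE, eF, hm, hp, hq]
    field_simp
    ring
  -- The factor `exp (p x)` centres the rates `c = p + q` and `d = p - q`. Then `Y` and `Z` satisfy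
  -- a first-order system of Bessel type, and `τ = Z / (x Y)` is the quotient `I_{α+1/2}(q x) /
  -- I_{α-1/2}(q x)`.
  set Y : ℝ → ℝ := fun x => Real.exp (p * x) * u x with hY
  set Z : ℝ → ℝ := fun x => m * (Real.exp (p * x) * v x) with hZ
  have hYpos (x : ℝ) (hx : 0 < x) : 0 < Y x := mul_pos (Real.exp_pos _) (hupos x hx)
  have hZpos (x : ℝ) (hx : 0 < x) : 0 < Z x :=
    mul_pos hm0 (mul_pos (Real.exp_pos _) (hvpos x hx))
  have dexp (x : ℝ) : HasDerivAt (fun x => Real.exp (p * x)) (Real.exp (p * x) * (p * 1)) x :=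
    ((hasDerivAt_id x).const_mul p).exp
  have dY (x : ℝ) (hx : 0 < x) : HasDerivAt Y (((2 * α - 1) * Y x + q * Z x) / x) x := by
    refine ((dexp x).mul (du x hx)).congr_deriv ?_
    simp only [hY, hZ]
    field_simp
    ring
  have dZ (x : ℝ) : HasDerivAt Z (q * x * Y x) x := by
    refine (((dexp x).mul (dv x)).const_mul m).congr_deriv ?_
    simp only [hY]
    rw [eF, hm, hp, hq]
    field_simp
    ring
  have hYc : Continuous Y := by simp only [hY]; fun_prop
  have hZc : Continuous Z := by simp only [hZ]; fun_prop
  have hZle (x : ℝ) (hx : 0 < x) : Z x ≤ q * x ^ 2 * Y x := by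
    have dW (x : ℝ) (hx : 0 < x) : HasDerivAt (fun x => q * x ^ 2 * Y x - Z x)
        (q * x * Y x + q * x * ((2 * α - 1) * Y x + q * Z x)) x := by
      refine (((((hasDerivAt_id x).pow 2).const_mul q).mul (dY x hx)).sub (dZ x)).congr_deriv ?_
      simp only [Pi.pow_apply, id]
      field_simp
      ring
    have hmono : MonotoneOn (fun x => q * x ^ 2 * Y x - Z x) (Set.Ici 0) := by
      refine monotoneOn_of_deriv_nonneg (convex_Ici 0) (by fun_prop) (fun z hz => ?_) fun z hz => ?_
      · rw [interior_Ici] at hz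
        exact (dW z hz).differentiableAt.differentiableWithinAt
      · rw [interior_Ici] at hz
        rw [(dW z hz).deriv]
        have := hYpos z hz
        have := hZpos z hz
        have hz : 0 < z := hz
        have : 0 ≤ 2 * α - 1 := by linarith
        positivity
    have := hmono (Set.mem_Ici.2 le_rfl) (Set.mem_Ici.2 hx.le) hx.le
    have h0 : Z 0 = 0 := by simp [hZ, hv, mul_apply_zero]
    simp only [h0] at this
    simp at this
    exact this
  set τ : ℝ → ℝ := fun x => Z x / (x * Y x) with hτ
  have dτ (x : ℝ) (hx : 0 < x) : HasDerivAt τ (q * (1 - τ x ^ 2) - 2 * α * τ x / x) x := by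
    have hy := hYpos x hx
    refine ((dZ x).div ((hasDerivAt_id x).mul (dY x hx)) (by simp; exact ⟨hx.ne', hy.ne'⟩)).congr_deriv
      ?_
    simp only [hτ, Pi.mul_apply, id]
    field_simp
    ring
  have τpos (x : ℝ) (hx : 0 < x) : 0 < τ x := div_pos (hZpos x hx) (mul_pos hx (hYpos x hx))
  have τle (x : ℝ) (hx : 0 < x) : τ x ≤ q * x := by
    rw [hτ]
    simp only
    rw [div_le_iff₀ (mul_pos hx (hYpos x hx))]
    refine (hZle x hx).trans_eq (by ring)
  have key := Riccati.crossesDown (p := p) hα hq0 dτ τpos τle hk₁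
    (show 0 ≤ k₂ * (c * d / α) by positivity) (show 0 ≤ k₃ / m by positivity) (by
      rcases hk₁.lt_or_eq with h | h
      · positivity
      rcases hk₂.lt_or_eq with h' | h'
      · positivity
      have : 0 < k₃ := by linarith
      positivity)
  refine ⟨fun x => k₁ * (((2 * α - 1) * u x + q * m * v x) / x - p * u x)
    + k₂ * (d * (c * (u x - E x)) + c * (d * (u x - F x))) + k₃ * (c * (F x - v x)), ?_, ?_⟩
  · intro x hx
    exact (((du x hx).const_mul k₁).add ((((dE x).const_mul d).add
      ((dF x).const_mul c)).const_mul k₂)).add ((dv x).const_mul k₃)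
  · refine key.of_pos_mul (w := fun x => u x / x) (fun x hx => div_pos (hupos x hx) hx) ?_
    intro x hx
    have hux := hupos x hx
    have e : τ x = m * v x / (x * u x) := by
      simp only [hτ, hZ, hY]
      field_simp
    simp only [e]
    have hcd : c - d ≠ 0 := by linarith
    rw [eE, eF, hm, hp, hq]
    field_simp
    ring

end Volterra

/-! ### Products of gamma factors and factorization of pairs of generators. -/

namespace Volterra

/-- The product of the convolution operators by gamma densities with rates `l i`, `i ∈ s`. -/
noncomputable def gamProd {α : ℝ} (hα : 1 ≤ α) {ι : Type*} (s : Finset ι) (l : ι → ℝ) :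
    VolterraUnit := ∏ i ∈ s, (gam hα (l i) : VolterraUnit)

/-- The convolution of `g` with the gamma densities with rates `l i`, `i ∈ s`. -/
noncomputable def conv {α : ℝ} (hα : 1 ≤ α) {ι : Type*} (s : Finset ι) (l : ι → ℝ) (g : Volterra) :
    Volterra := (gamProd hα s l * (g : VolterraUnit)).snd

section conv

variable {α : ℝ} (hα : 1 ≤ α) {ι : Type*} (s : Finset ι) (l : ι → ℝ)

theorem inr_conv (g : Volterra) :
    ((conv hα s l g : Volterra) : VolterraUnit) = gamProd hα s l * (g : VolterraUnit) := by
  ext1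
  · simp
  · rfl

theorem inr_inj {f g : Volterra} : (f : VolterraUnit) = (g : VolterraUnit) ↔ f = g :=
  Unitization.inr_injective.eq_iff

theorem conv_empty (g : Volterra) : conv hα (∅ : Finset ι) l g = g := by
  rw [← inr_inj, inr_conv]; simp [gamProd]

theorem conv_insert [DecidableEq ι] {s : Finset ι} {i : ι} (hi : i ∉ s) (g : Volterra) :
    conv hα (insert i s) l g = gam hα (l i) * conv hα s l g := by
  rw [← inr_inj, inr_conv, Unitization.inr_mul, inr_conv, gamProd, prod_insert hi, mul_assoc,
    gamProd]

theorem conv_mul_left (f g : Volterra) : conv hα s l (f * g) = f * conv hα s l g := by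
  rw [← inr_inj, inr_conv, Unitization.inr_mul, Unitization.inr_mul, inr_conv]; ring

theorem conv_erase [DecidableEq ι] {s : Finset ι} {i : ι} (hi : i ∈ s) (g : Volterra) :
    conv hα s l g = conv hα (s.erase i) l (gam hα (l i) * g) := by
  rw [conv_mul_left, ← conv_insert hα l (notMem_erase i s), insert_erase hi]

theorem conv_add (f g : Volterra) : conv hα s l (f + g) = conv hα s l f + conv hα s l g := by
  rw [← inr_inj, inr_conv, Unitization.inr_add, Unitization.inr_add, inr_conv, inr_conv, mul_add]

theorem conv_smul (c : ℝ) (g : Volterra) : conv hα s l (c • g) = c • conv hα s l g := by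
  rw [← inr_inj, inr_conv, Unitization.inr_smul, Unitization.inr_smul, inr_conv, mul_smul_comm]

theorem conv_sub (f g : Volterra) : conv hα s l (f - g) = conv hα s l f - conv hα s l g := by
  rw [sub_eq_add_neg, ← neg_one_smul ℝ g, conv_add, conv_smul, neg_one_smul, ← sub_eq_add_neg]

variable {s l}

theorem crossesDown_conv (hl : ∀ i ∈ s, 0 < l i) {g : Volterra} (hg : CrossesDown g) :
    CrossesDown (conv hα s l g) := by
  classical
  induction s using Finset.induction_on with
  | empty => rwa [conv_empty]
  | insert i s hi ih =>
    rw [conv_insert hα l hi]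
    exact (ih fun j hj => hl j (mem_insert_of_mem hj)).gam_mul hα (hl i (mem_insert_self i s))

theorem conv_pos (hl : ∀ i ∈ s, 0 < l i) {g : Volterra} {r : ℝ}
    (hg : ∀ x, 0 < x → x < r → 0 < g x) : ∀ x, 0 < x → x < r → 0 < conv hα s l g x := by
  classical
  induction s using Finset.induction_on with
  | empty => rwa [conv_empty]
  | insert i s hi ih =>
    intro x hx hxr
    rw [conv_insert hα l hi]
    exact mul_pos_of_pos hx (fun t ht => gam_pos hα (hl i (mem_insert_self i s)) ht)
      fun t ht htx => ih (fun j hj => hl j (mem_insert_of_mem hj)) t ht (htx.trans hxr)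

end conv

/-- A positive multiple of `expo a - expo b` when `b < a`. -/
noncomputable def gen (b a : ℝ) : Volterra := expo b - expo b * expo a

theorem sub_smul_gen (b a : ℝ) : (a - b) • gen b a = b • (expo a - expo b) := by
  rw [gen, smul_sub, expo_mul_expo]; module

/-- The ratio `(gam - expo a * gam) / gam` is strictly decreasing: `(expo a * gam) x / gam x`
integrates `expo a t` against `gam (x - t) / gam x`, which increases with `x` by `gam_ratio`, over a
growing interval. A common denominator lets such functions be added. -/
theorem gam_sub_div_lt {α : ℝ} (hα : 1 ≤ α) {l a x y : ℝ} (hl : 0 < l) (ha : 0 < a) (hx : 0 < x)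
    (hxy : x < y) :
    (gam hα l - expo a * gam hα l) y * gam hα l x < (gam hα l - expo a * gam hα l) x * gam hα l y := by
  have hgx := gam_pos hα hl hx
  have hgy := gam_pos hα hl (hx.trans hxy)
  have h1 : (expo a * gam hα l) x * gam hα l y ≤ ∫ t in (0 : ℝ)..x, expo a t * gam hα l (y - t) * gam hα l x := by
    rw [mul_apply', ← intervalIntegral.integral_mul_const]
    refine intervalIntegral.integral_mono_on hx.le (Continuous.intervalIntegrable (by fun_prop) _ _)
      (Continuous.intervalIntegrable (by fun_prop) _ _) fun t ht => ?_
    have := gam_ratio hα hl hxy.le ht.1 ht.2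
    rw [sub_zero, sub_zero] at this
    have := mul_le_mul_of_nonneg_left this (expo_pos ha t).le
    linarith
  have h2 : 0 < ∫ t in x..y, expo a t * gam hα l (y - t) * gam hα l x :=
    intervalIntegral.intervalIntegral_pos_of_pos_on (Continuous.intervalIntegrable (by fun_prop) _ _)
      (fun t ht => mul_pos (mul_pos (expo_pos ha t) (gam_pos hα hl (by linarith [ht.2]))) hgx) hxy
  have h3 := intervalIntegral.integral_add_adjacent_intervals (μ := volume)
    (f := fun t => expo a t * gam hα l (y - t) * gam hα l x) (a := 0) (b := x) (c := y)
    (Continuous.intervalIntegrable (by fun_prop) _ _)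
    (Continuous.intervalIntegrable (by fun_prop) _ _)
  have h4 : ∫ t in (0 : ℝ)..y, expo a t * gam hα l (y - t) * gam hα l x
      = (expo a * gam hα l) y * gam hα l x := by
    rw [mul_apply', ← intervalIntegral.integral_mul_const]
  simp only [sub_apply]
  linarith

theorem crossesDown_gam_sub {α : ℝ} (hα : 1 ≤ α) {l a a' k k' : ℝ} (hl : 0 < l) (ha : 0 < a)
    (ha' : 0 < a') (hk : 0 ≤ k) (hk' : 0 ≤ k') (hkk : 0 < k + k') :
    CrossesDown (k • (gam hα l - expo a * gam hα l) + k' • (gam hα l - expo a' * gam hα l) :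
      Volterra) := by
  intro x y hx hxy h
  have hgx := gam_pos hα hl hx
  have hgy := gam_pos hα hl (hx.trans hxy)
  have h1 := gam_sub_div_lt hα hl ha hx hxy
  have h2 := gam_sub_div_lt hα hl ha' hx hxy
  set g := (gam hα l - expo a * gam hα l : Volterra)
  set g' := (gam hα l - expo a' * gam hα l : Volterra)
  simp only [add_apply, smul_apply] at h ⊢
  have h3 : (k * g y + k' * g' y) * gam hα l x < (k * g x + k' * g' x) * gam hα l y := by
    rcases hk.lt_or_eq with hk0 | hk0
    · have := mul_lt_mul_of_pos_left h1 hk0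
      have := mul_le_mul_of_nonneg_left h2.le hk'
      linarith
    · have := mul_lt_mul_of_pos_left h2 (show 0 < k' by linarith)
      rw [← hk0]
      linarith
  have h4 : (k * g x + k' * g' x) * gam hα l y ≤ 0 := mul_nonpos_of_nonpos_of_nonneg h hgy.le
  by_contra h5
  have := mul_nonneg (not_lt.1 h5) hgx.le
  linarith

section pair

variable {α : ℝ} (hα : 1 ≤ α) {ι : Type*} [DecidableEq ι] {s : Finset ι} {l : ι → ℝ}

/-- Since `gen b a = expo b - expo b * expo a`, the factor `expo b` is common. A single gamma
density absorbs the rest into a function covered by `crossesDown_gam_sub`. -/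
theorem conv_gen_same (hl : ∀ i ∈ s, 0 < l i) (hs : s.Nonempty) {b a a' k k' : ℝ} (ha : 0 < a)
    (ha' : 0 < a') (hk : 0 ≤ k) (hk' : 0 ≤ k') (hkk : 0 < k + k') :
    ∃ W : Volterra, CrossesDown W ∧
      k • conv hα s l (gen b a) + k' • conv hα s l (gen b a') = expo b * W := by
  obtain ⟨i, hi⟩ := hs
  refine ⟨conv hα (s.erase i) l (k • (gam hα (l i) - expo a * gam hα (l i))
      + k' • (gam hα (l i) - expo a' * gam hα (l i))),
    crossesDown_conv hα (fun j hj => hl j (mem_of_mem_erase hj))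
      (crossesDown_gam_sub hα (hl i hi) ha ha' hk hk' hkk), ?_⟩
  rw [← conv_smul, ← conv_smul, ← conv_add, conv_erase hα l hi, ← conv_mul_left]
  congr 1
  rw [← inr_inj]
  simp only [gen, Unitization.inr_mul, Unitization.inr_add, Unitization.inr_sub,
    Unitization.inr_smul, Algebra.smul_def]
  ring

theorem inr_expo_mul_expo (a b : ℝ) :
    (algebraMap ℝ VolterraUnit b - algebraMap ℝ VolterraUnit a) *
      ((expo a : VolterraUnit) * (expo b : VolterraUnit))
      = algebraMap ℝ VolterraUnit b * (expo a : VolterraUnit)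
        - algebraMap ℝ VolterraUnit a * (expo b : VolterraUnit) := by
  have := congrArg (fun f : Volterra => (f : VolterraUnit)) (expo_mul_expo a b)
  simpa only [Unitization.inr_mul, Unitization.inr_sub, Unitization.inr_smul, Algebra.smul_def,
    map_sub] using this

/-- On Laplace transforms `h` is `2 c d (a + s)(b + s) / ((c + s)(d + s))` times `u`. Expand using
`a + s = (a - d) + (d + s)` and `b + s = (b - c) + (c + s)`. Then symmetrize with `expo_mul_expo`,
so that `expo c * u` and `expo d * u` enter only through the combination that is a multiple of `x
u`. -/
theorem expo_mul_combination (a b c d : ℝ) (u : Volterra) {h : Volterra}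
    (hh : h = (2 * (c * d)) • u + ((b - c) + (a - d)) • (d • (expo c * u) + c • (expo d * u))
      + (2 * ((b - c) * (a - d)) + (c - d) * (a - b + c - d)) • (expo c * (expo d * u))) :
    expo b * (h - expo a * h) = (2 * (b * d)) • (gen c d * u) := by
  have r1 := inr_expo_mul_expo b c
  have r2 := inr_expo_mul_expo a d
  have r3 := inr_expo_mul_expo c d
  rw [← inr_inj]
  simp only [gen, hh, Unitization.inr_mul, Unitization.inr_add, Unitization.inr_sub,
    Unitization.inr_smul, Algebra.smul_def, map_sub, map_add, map_mul, map_ofNat] at *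
  generalize algebraMap ℝ VolterraUnit a = A at *
  generalize algebraMap ℝ VolterraUnit b = B at *
  generalize algebraMap ℝ VolterraUnit c = C at *
  generalize algebraMap ℝ VolterraUnit d = D at *
  generalize (u : VolterraUnit) = U at *
  generalize (expo a : VolterraUnit) = ea at *
  generalize (expo b : VolterraUnit) = eb at *
  generalize (expo c : VolterraUnit) = ec at *
  generalize (expo d : VolterraUnit) = ed at *
  linear_combination (-2 * U * (1 - ea) * ((A - D) * ed + D)) * r1 + (2 * U * B * ec) * r2
    - (eb * (1 - ea) * U * ((A - D) - (B - C))) * r3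

/-- The gamma factors at `i` and `j` form `u`. By `expo_mul_combination` both generators applied to
`u` have the form `expo b * (h - expo a * h)`, so the combination is governed by one `h`. -/
theorem conv_gen_cross (hl : ∀ i ∈ s, 0 < l i) {i j : ι} (hi : i ∈ s) (hj : j ∈ s) (hij : i ≠ j)
    {a b k k' : ℝ} (hba : b < a) (hcb : l i ≤ b) (hdc : l j < l i)
    (hk : 0 ≤ k) (hk' : 0 ≤ k') (hkk : 0 < k + k') :
    ∃ W : Volterra, CrossesDown W ∧
      k • conv hα s l (gen b a) + k' • conv hα s l (gen (l i) (l j)) = expo b * W := by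
  have hj' : j ∈ s.erase i := mem_erase.2 ⟨hij.symm, hj⟩
  have hc := hl i hi
  have hd := hl j hj
  set c := l i with hcdef
  set d := l j with hddef
  set u := gam hα c * gam hα d with hu
  have hb : 0 < b := hc.trans_le hcb
  set m := k' / (2 * (b * d)) with hm
  have hm0 : 0 ≤ m := by positivity
  have hmb : m * (2 * (b * d)) = k' := by rw [hm]; field_simp
  set g : Volterra := (2 * (c * d)) • u + ((b - c) + (a - d)) • (d • (expo c * u) + c • (expo d * u))
      + (2 * ((b - c) * (a - d)) + (c - d) * (a - b + c - d)) • (expo c * (expo d * u)) with hg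
  have hgc := expo_mul_combination a b c d u hg
  have e : k • u + m • g = (k + m * (2 * (c * d))) • u
      + (m * ((b - c) + (a - d))) • (d • (expo c * u) + c • (expo d * u))
      + (m * (2 * ((b - c) * (a - d)) + (c - d) * (a - b + c - d))) • (expo c * (expo d * u)) := by
    rw [hg, smul_add, smul_add, smul_smul, smul_smul, smul_smul, add_smul]
    abel
  have n2 : 0 ≤ m * ((b - c) + (a - d)) := mul_nonneg hm0 (by linarith)
  -- Here the full ordering `d < c ≤ b < a` of the rates enters.
  have n3 : 0 ≤ m * (2 * ((b - c) * (a - d)) + (c - d) * (a - b + c - d)) := by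
    refine mul_nonneg hm0 (add_nonneg ?_ ?_)
    · exact mul_nonneg zero_le_two (mul_nonneg (by linarith) (by linarith))
    · exact mul_nonneg (by linarith) (by linarith)
  have n1 : 0 < k + m * (2 * (c * d)) := by
    rcases hk.lt_or_eq with h | h
    · positivity
    · have h' : 0 < k' := by linarith
      have : 0 < m := by positivity
      positivity
  obtain ⟨h', hd', hcd⟩ := exists_hasDerivAt_crossesDown hα hd hdc n1.le n2 n3
    (by linarith) hu
  rw [← e] at hd'
  have h0 : (k • u + m • g) 0 = 0 := by
    simp [hg, hu, mul_apply_zero]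
  refine ⟨conv hα ((s.erase i).erase j) l ((k • u + m • g) - expo a * (k • u + m • g)),
    crossesDown_conv hα (fun t ht => hl t (mem_of_mem_erase (mem_of_mem_erase ht)))
      (crossesDown_sub_expo_mul h0 hd' hcd a), ?_⟩
  rw [← conv_smul, ← conv_smul, ← conv_add, conv_erase hα l hi, conv_erase hα l hj',
    ← conv_mul_left]
  congr 1
  rw [← inr_inj] at hgc ⊢
  have hk2 : algebraMap ℝ VolterraUnit k' = algebraMap ℝ VolterraUnit m *
      algebraMap ℝ VolterraUnit (2 * (b * d)) := by rw [← map_mul, hmb]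
  clear_value g
  simp only [gen, hu, Unitization.inr_mul, Unitization.inr_add, Unitization.inr_sub,
    Unitization.inr_smul, Algebra.smul_def] at hgc ⊢
  rw [← hcdef, ← hddef, hk2]
  linear_combination (-algebraMap ℝ VolterraUnit m) * hgc

/-- At a zero the derivative of `expo b * W` is `b * W x`, and `W` must already have turned negative
for the integral to vanish. -/
theorem deriv_neg_of_eq_expo_mul {f W : Volterra} {b : ℝ} (hb : 0 < b) (hW : CrossesDown W)
    (hf : f = expo b * W) {x : ℝ} (hx : 0 < x) (h : f x = 0) : deriv f x < 0 := by
  subst hf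
  rw [(hasDerivAt_expo_mul b W x).deriv, h, sub_zero]
  exact mul_neg_of_pos_of_neg hb (hW.neg_of_expo_mul_eq_zero hb hx h)

end pair

end Volterra

/-! ### Exponential decay and negativity near infinity. -/

namespace Volterra

/-- Exponential decay on `[0, ∞)`. -/
def Decays (f : Volterra) : Prop := ∃ c M : ℝ, 0 < c ∧ ∀ x, 0 ≤ x → |f x| ≤ M * Real.exp (-(c * x))

theorem Decays.nonneg_bound {f : Volterra} {c M : ℝ}
    (h : ∀ x, 0 ≤ x → |f x| ≤ M * Real.exp (-(c * x))) : 0 ≤ M := by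
  have := (abs_nonneg _).trans (h 0 le_rfl)
  simpa using this

theorem Decays.mul {f g : Volterra} (hf : Decays f) (hg : Decays g) : Decays (f * g) := by
  obtain ⟨a, M, ha, hM⟩ := hf
  obtain ⟨b, N, hb, hN⟩ := hg
  have hM0 := Decays.nonneg_bound hM
  have hN0 := Decays.nonneg_bound hN
  set c := min a b
  have hc : 0 < c := lt_min ha hb
  refine ⟨c / 2, M * N * (2 / c), half_pos hc, fun x hx => ?_⟩
  have h1 : |(f * g) x| ≤ ∫ t in (0 : ℝ)..x, M * N * Real.exp (-(c * x)) := by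
    rw [mul_apply]
    refine (intervalIntegral.abs_integral_le_integral_abs hx).trans ?_
    refine intervalIntegral.integral_mono_on hx (Continuous.intervalIntegrable (by fun_prop) _ _)
      (Continuous.intervalIntegrable (by fun_prop) _ _) fun t ht => ?_
    have e1 : |f (x - t)| ≤ M * Real.exp (-(c * (x - t))) := by
      refine (hM _ (by linarith [ht.2])).trans (mul_le_mul_of_nonneg_left ?_ hM0)
      refine Real.exp_le_exp.2 (neg_le_neg ?_)
      exact mul_le_mul_of_nonneg_right (min_le_left _ _) (by linarith [ht.2])
    have e2 : |g t| ≤ N * Real.exp (-(c * t)) := by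
      refine (hN _ ht.1).trans (mul_le_mul_of_nonneg_left ?_ hN0)
      refine Real.exp_le_exp.2 (neg_le_neg ?_)
      exact mul_le_mul_of_nonneg_right (min_le_right _ _) ht.1
    rw [abs_mul]
    refine (mul_le_mul e1 e2 (abs_nonneg _) (by positivity)).trans_eq ?_
    rw [show -(c * x) = -(c * (x - t)) + -(c * t) by ring, Real.exp_add]
    ring
  rw [intervalIntegral.integral_const, sub_zero, smul_eq_mul] at h1
  refine h1.trans ?_
  have h2 : x ≤ 2 / c * Real.exp (c / 2 * x) := by
    have := Real.add_one_le_exp (c / 2 * x)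
    calc x = 2 / c * (c / 2 * x) := by field_simp
      _ ≤ 2 / c * Real.exp (c / 2 * x) := by gcongr; linarith
  calc x * (M * N * Real.exp (-(c * x)))
      ≤ (2 / c * Real.exp (c / 2 * x)) * (M * N * Real.exp (-(c * x))) := by gcongr
    _ = M * N * (2 / c) * (Real.exp (c / 2 * x) * Real.exp (-(c * x))) := by ring
    _ = M * N * (2 / c) * Real.exp (-(c / 2 * x)) := by rw [← Real.exp_add]; ring_nf

theorem decays_gam {α : ℝ} (hα : 1 ≤ α) {l : ℝ} (hl : 0 < l) : Decays (gam hα l) := by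
  have h1 := tendsto_rpow_mul_exp_neg_mul_atTop_nhds_zero (α - 1) (l / 2) (half_pos hl)
  have h2 : Continuous fun x : ℝ => x ^ (α - 1) * Real.exp (-(l / 2) * x) := by
    have : Continuous fun x : ℝ => x ^ (α - 1) := Real.continuous_rpow_const (by linarith)
    fun_prop
  obtain ⟨X, hX⟩ := Filter.eventually_atTop.1 (h1.eventually (gt_mem_nhds zero_lt_one))
  obtain ⟨B, hB⟩ := (isCompact_Icc (a := 0) (b := X)).bddAbove_image h2.continuousOn
  have hG := Real.Gamma_pos_of_pos (show 0 < α by linarith)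
  refine ⟨l / 2, l ^ α / Real.Gamma α * max B 1, half_pos hl, fun x hx => ?_⟩
  have h3 : x ^ (α - 1) * Real.exp (-(l / 2) * x) ≤ max B 1 := by
    rcases le_total x X with h | h
    · exact (hB ⟨x, ⟨hx, h⟩, rfl⟩).trans (le_max_left _ _)
    · exact (hX x h).le.trans (le_max_right _ _)
  rw [abs_of_nonneg (gam_nonneg hα hl hx), gam_apply]
  calc _ = l ^ α / Real.Gamma α * (x ^ (α - 1) * Real.exp (-(l / 2) * x)) * Real.exp (-(l / 2 * x)) := by
        rw [show -(l * x) = -(l / 2) * x + -(l / 2 * x) by ring, Real.exp_add]; ring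
    _ ≤ _ := by gcongr

theorem decays_conv {α : ℝ} (hα : 1 ≤ α) {ι : Type*} {s : Finset ι} {l : ι → ℝ}
    (hl : ∀ i ∈ s, 0 < l i) {g : Volterra} (hg : Decays g) : Decays (conv hα s l g) := by
  classical
  induction s using Finset.induction_on with
  | empty => rwa [conv_empty]
  | insert i s hi ih =>
    rw [conv_insert hα l hi]
    exact (decays_gam hα (hl i (mem_insert_self i s))).mul
      (ih fun j hj => hl j (mem_insert_of_mem hj))

theorem Decays.tendsto {f : Volterra} (hf : Decays f) :
    Filter.Tendsto f Filter.atTop (nhds 0) := by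
  obtain ⟨c, M, hc, hM⟩ := hf
  have h1 : Filter.Tendsto (fun x => M * Real.exp (-(c * x))) Filter.atTop (nhds 0) := by
    have := (Real.tendsto_exp_neg_atTop_nhds_zero.comp
      (Filter.tendsto_id.const_mul_atTop hc)).const_mul M
    simpa using this
  refine squeeze_zero_norm' ?_ h1
  filter_upwards [Filter.eventually_ge_atTop 0] with x hx using hM x hx

theorem decays_expo {l : ℝ} (hl : 0 < l) : Decays (expo l) :=
  ⟨l, l, hl, fun x _ => by rw [abs_of_pos (expo_pos hl x), expo_apply]⟩

theorem Decays.sub {f g : Volterra} (hf : Decays f) (hg : Decays g) : Decays (f - g) := by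
  obtain ⟨a, M, ha, hM⟩ := hf
  obtain ⟨b, N, hb, hN⟩ := hg
  have hM0 := Decays.nonneg_bound hM
  have hN0 := Decays.nonneg_bound hN
  refine ⟨min a b, M + N, lt_min ha hb, fun x hx => ?_⟩
  rw [sub_apply, add_mul]
  refine (abs_sub _ _).trans (add_le_add ((hM x hx).trans ?_) ((hN x hx).trans ?_))
  · refine mul_le_mul_of_nonneg_left (Real.exp_le_exp.2 (neg_le_neg ?_)) hM0
    exact mul_le_mul_of_nonneg_right (min_le_left _ _) hx
  · refine mul_le_mul_of_nonneg_left (Real.exp_le_exp.2 (neg_le_neg ?_)) hN0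
    exact mul_le_mul_of_nonneg_right (min_le_right _ _) hx

theorem Decays.smul {f : Volterra} (hf : Decays f) (k : ℝ) : Decays (k • f) := by
  obtain ⟨a, M, ha, hM⟩ := hf
  refine ⟨a, |k| * M, ha, fun x hx => ?_⟩
  rw [smul_apply, abs_mul, mul_assoc]
  exact mul_le_mul_of_nonneg_left (hM x hx) (abs_nonneg k)

theorem gen_apply {b a : ℝ} (h : a ≠ b) (x : ℝ) :
    gen b a x = b / (a - b) * (expo a x - expo b x) := by
  have := DFunLike.congr_fun (sub_smul_gen b a) x
  simp only [smul_apply, sub_apply] at this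
  have h2 : a - b ≠ 0 := sub_ne_zero.2 h
  field_simp
  linarith

theorem crossesDown_gen {b a : ℝ} (hb : 0 < b) (hba : b < a) : CrossesDown (gen b a) := by
  intro x y hx hxy h
  have ha := hb.trans hba
  have hk : 0 < b / (a - b) := div_pos hb (by linarith)
  rw [gen_apply hba.ne'] at h ⊢
  have h1 : a * Real.exp (-(a * x)) ≤ b * Real.exp (-(b * x)) := by
    by_contra h2
    have : 0 < expo a x - expo b x := by rw [expo_apply, expo_apply]; linarith
    exact absurd (mul_pos hk this) (not_lt.2 h)
  have h2 : a * Real.exp (-(a * y)) < b * Real.exp (-(b * y)) := by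
    have e1 : Real.exp (-(a * y)) = Real.exp (-(a * x)) * Real.exp (-(a * (y - x))) := by
      rw [← Real.exp_add]; ring_nf
    have e2 : Real.exp (-(b * y)) = Real.exp (-(b * x)) * Real.exp (-(b * (y - x))) := by
      rw [← Real.exp_add]; ring_nf
    have e3 : Real.exp (-(a * (y - x))) < Real.exp (-(b * (y - x))) := by
      refine Real.exp_lt_exp.2 (neg_lt_neg ?_)
      exact mul_lt_mul_of_pos_right hba (by linarith)
    rw [e1, e2, ← mul_assoc, ← mul_assoc]
    exact mul_lt_mul' h1 e3 (Real.exp_pos _).le (by positivity)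
  refine mul_neg_of_pos_of_neg hk ?_
  rw [expo_apply, expo_apply]; linarith

/-- Convolutions of `gen b a` are negative somewhere, as they have integral zero. -/
theorem exists_conv_gen_neg {α : ℝ} (hα : 1 ≤ α) {ι : Type*} {s : Finset ι} {l : ι → ℝ}
    (hl : ∀ i ∈ s, 0 < l i) {b a : ℝ} (hb : 0 < b) (hba : b < a) :
    ∃ x, 0 < x ∧ conv hα s l (gen b a) x < 0 := by
  by_contra hcon
  push Not at hcon
  have ha := hb.trans hba
  -- This is `exp (-b x) - exp (-a x)`, the primitive of `expo a - expo b` vanishing at `0`. It is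
  -- positive on `(0, ∞)` and decays, so a convolution of it cannot be nondecreasing.
  set w : Volterra := b⁻¹ • expo b - a⁻¹ • expo a with hw
  have e : unitStep * (expo a - expo b) = w := by
    have e1 (c : ℝ) (hc : 0 < c) : unitStep * expo c = unitStep - c⁻¹ • expo c := by
      nth_rewrite 2 [← smul_unitStep_sub c]
      rw [smul_smul, inv_mul_cancel₀ hc.ne', one_smul, mul_comm]
      abel
    rw [mul_sub, e1 a ha, e1 b hb, hw]
    abel
  have e2 : unitStep * conv hα s l (gen b a) = (b / (a - b)) • conv hα s l w := by
    have : gen b a = (b / (a - b)) • (expo a - expo b) := by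
      ext x; rw [gen_apply hba.ne', smul_apply, sub_apply]
    rw [this, conv_smul, mul_smul_comm, ← conv_mul_left, e]
  have hk : 0 < b / (a - b) := div_pos hb (by linarith)
  set K := unitStep * conv hα s l (gen b a) with hK
  have hpos (x : ℝ) (hx : 0 < x) : 0 < K x := by
    rw [e2, smul_apply]
    refine mul_pos hk (conv_pos hα hl (r := x + 1) (fun y hy _ => ?_) x hx (by linarith))
    simp only [hw, sub_apply, smul_apply, expo_apply]
    rw [← mul_assoc, ← mul_assoc, inv_mul_cancel₀ hb.ne', inv_mul_cancel₀ ha.ne', one_mul, one_mul,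
      sub_pos]
    exact Real.exp_lt_exp.2 (neg_lt_neg (mul_lt_mul_of_pos_right hba hy))
  have hlim : Filter.Tendsto K Filter.atTop (nhds 0) := by
    rw [e2]
    exact ((decays_conv hα hl (((decays_expo hb).smul _).sub ((decays_expo ha).smul _))).smul _).tendsto
  have hmono : MonotoneOn K (Set.Ici 0) := by
    refine monotoneOn_of_deriv_nonneg (convex_Ici 0) (by fun_prop)
      (fun x _ => (hasDerivAt_unitStep_mul _ x).differentiableAt.differentiableWithinAt) fun x hx => ?_
    rw [interior_Ici] at hx
    rw [(hasDerivAt_unitStep_mul _ x).deriv]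
    exact hcon x hx
  have : K 1 ≤ 0 := by
    refine ge_of_tendsto hlim ?_
    filter_upwards [Filter.eventually_ge_atTop 1] with x hx
    exact hmono (Set.mem_Ici.2 zero_le_one) (Set.mem_Ici.2 (by linarith)) hx
  linarith [hpos 1 one_pos]

/-! ### Dependence on the rates. -/

/-- A family of functions depending jointly continuously on the parameter and the variable. -/
def JointlyContinuous {P : Type*} [TopologicalSpace P] (K : P → Volterra) : Prop :=
  Continuous fun q : P × ℝ => K q.1 q.2

namespace JointlyContinuous

variable {P : Type*} [TopologicalSpace P] {K K' : P → Volterra}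

theorem mul (h : JointlyContinuous K) (h' : JointlyContinuous K') :
    JointlyContinuous fun p => K p * K' p :=
  continuous_conv (f := fun p => K p) (g := fun p => K' p) h h'

theorem add (h : JointlyContinuous K) (h' : JointlyContinuous K') :
    JointlyContinuous fun p => K p + K' p := Continuous.add h h'

theorem sub (h : JointlyContinuous K) (h' : JointlyContinuous K') :
    JointlyContinuous fun p => K p - K' p := Continuous.sub h h'

theorem smul (h : JointlyContinuous K) {c : P → ℝ} (hc : Continuous c) :
    JointlyContinuous fun p => c p • K p :=
  Continuous.mul (hc.comp continuous_fst) h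

theorem const (g : Volterra) : JointlyContinuous fun _ : P => g :=
  g.continuous.comp continuous_snd

theorem expo {l : P → ℝ} (hl : Continuous l) : JointlyContinuous fun p => expo (l p) := by
  have : Continuous fun q : P × ℝ => l q.1 := hl.comp continuous_fst
  exact this.mul (Real.continuous_exp.comp (this.mul continuous_snd).neg)

theorem gam {α : ℝ} (hα : 1 ≤ α) {l : P → ℝ} (hl : Continuous l) :
    JointlyContinuous fun p => gam hα (l p) := by
  have h1 : Continuous fun q : P × ℝ => l q.1 := hl.comp continuous_fst
  have h2 : Continuous fun q : P × ℝ => l q.1 ^ α :=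
    (Real.continuous_rpow_const (by linarith)).comp h1
  have h3 : Continuous fun q : P × ℝ => q.2 ^ (α - 1) :=
    (Real.continuous_rpow_const (by linarith)).comp continuous_snd
  exact ((h2.div_const _).mul h3).mul (Real.continuous_exp.comp (h1.mul continuous_snd).neg)

theorem conv {α : ℝ} (hα : 1 ≤ α) {ι : Type*} (s : Finset ι) {l : P → ι → ℝ}
    (hl : ∀ i, Continuous fun p => l p i) (h : JointlyContinuous K) :
    JointlyContinuous fun p => conv hα s (l p) (K p) := by
  classical
  induction s using Finset.induction_on with
  | empty => simpa only [conv_empty] using h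
  | insert i s hi ih =>
    simp only [conv_insert hα _ hi]
    exact (gam hα (hl i)).mul ih

end JointlyContinuous

/-- `K'` is the derivative of the family `K` in the parameter, both jointly continuous. -/
structure HasParamDeriv (K K' : ℝ → Volterra) : Prop where
  cont : JointlyContinuous K
  cont' : JointlyContinuous K'
  deriv : ∀ t x, HasDerivAt (fun t => K t x) (K' t x) t

namespace HasParamDeriv

theorem mul {K K' L L' : ℝ → Volterra} (hK : HasParamDeriv K K') (hL : HasParamDeriv L L') :
    HasParamDeriv (fun t => K t * L t) fun t => K' t * L t + K t * L' t := by
  refine ⟨hK.cont.mul hL.cont, (hK.cont'.mul hL.cont).add (hK.cont.mul hL.cont'), fun t x => ?_⟩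
  set F' : ℝ → ℝ → ℝ := fun t y => K' t (x - y) * L t y + K t (x - y) * L' t y
  have c1 : Continuous fun q : ℝ × ℝ => K' q.1 (x - q.2) * L q.1 q.2 + K q.1 (x - q.2) * L' q.1 q.2 := by
    have a (M : ℝ → Volterra) (hM : JointlyContinuous M) :
        Continuous fun q : ℝ × ℝ => M q.1 (x - q.2) :=
      hM.comp (f := fun q : ℝ × ℝ => (q.1, x - q.2)) (by fun_prop)
    exact ((a _ hK.cont').mul hL.cont).add ((a _ hK.cont).mul hL.cont')
  obtain ⟨B, hB⟩ := ((isCompact_Icc (a := t - 1) (b := t + 1)).prod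
    (isCompact_uIcc (a := 0) (b := x))).exists_bound_of_continuousOn c1.continuousOn
  have key := intervalIntegral.hasDerivAt_integral_of_dominated_loc_of_deriv_le (μ := volume)
    (a := 0) (b := x) (F := fun t y => K t (x - y) * L t y) (F' := F') (x₀ := t)
    (s := Set.Icc (t - 1) (t + 1)) (bound := fun _ => B)
    (Icc_mem_nhds (by linarith) (by linarith))
    (Filter.Eventually.of_forall fun t => (Continuous.aestronglyMeasurable (by fun_prop)))
    (Continuous.intervalIntegrable (by fun_prop) _ _)
    (Continuous.aestronglyMeasurable (by fun_prop))
    (Filter.Eventually.of_forall fun y hy t' ht' => hB (t', y) ⟨ht', Set.uIoc_subset_uIcc hy⟩)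
    (intervalIntegrable_const)
    (Filter.Eventually.of_forall fun y hy t' ht' => (hK.deriv t' (x - y)).mul (hL.deriv t' y))
  refine key.2.congr_deriv ?_
  rw [add_apply, mul_apply, mul_apply]
  exact intervalIntegral.integral_add (Continuous.intervalIntegrable (by fun_prop) _ _)
    (Continuous.intervalIntegrable (by fun_prop) _ _)

theorem const (g : Volterra) : HasParamDeriv (fun _ => g) fun _ => 0 :=
  ⟨JointlyContinuous.const g, JointlyContinuous.const 0, fun t x => by
    simpa using hasDerivAt_const t (g x)⟩

/-- Differentiation in the rate multiplies the density by `α / l - x`, and `mul_gam_apply` converts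
the factor `x` into convolution with `expo l`. -/
theorem gam {α : ℝ} (hα : 1 ≤ α) {l l' : ℝ → ℝ} (hl : ∀ t, 0 < l t)
    (hd : ∀ t, HasDerivAt l (l' t) t) (hc : Continuous l') :
    HasParamDeriv (fun t => gam hα (l t))
      fun t => (l' t * α / l t) • (Volterra.gam hα (l t) - expo (l t) * Volterra.gam hα (l t)) := by
  have hlc : Continuous l := continuous_iff_continuousAt.2 fun t => (hd t).continuousAt
  have c1 := JointlyContinuous.gam hα hlc
  refine ⟨c1, (c1.sub ((JointlyContinuous.expo hlc).mul c1)).smul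
    ((hc.mul continuous_const).div hlc fun t => (hl t).ne'), fun t x => ?_⟩
  have h1 := (((hd t).rpow_const (p := α) (Or.inl (hl t).ne')).div_const (Real.Gamma α)).mul_const
    (x ^ (α - 1))
  have h2 := h1.mul (((hd t).mul_const x).neg.exp)
  refine h2.congr_deriv ?_
  have h3 := mul_gam_apply hα (l t) x
  rw [smul_apply, sub_apply, mul_comm (expo (l t))]
  have h4 : (Volterra.gam hα (l t) * expo (l t)) x = l t * x * Volterra.gam hα (l t) x / α := by
    field_simp; linarith
  rw [h4, gam_apply, Real.rpow_sub_one (hl t).ne']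
  have := hl t
  simp only [Pi.neg_apply]
  field_simp
  ring

/-- A logarithmic derivative: each gamma factor contributes itself times a scalar multiple of `1 -
expo`, so the whole product reappears in every summand. -/
theorem conv {α : ℝ} (hα : 1 ≤ α) {ι : Type*} (s : Finset ι) {l l' : ℝ → ι → ℝ}
    (hl : ∀ t i, 0 < l t i) (hd : ∀ t i, HasDerivAt (fun t => l t i) (l' t i) t)
    (hc : ∀ i, Continuous fun t => l' t i) (g : Volterra) :
    HasParamDeriv (fun t => conv hα s (l t) g) fun t => ∑ i ∈ s,
      (l' t i * α / l t i) • (Volterra.conv hα s (l t) g - expo (l t i) * Volterra.conv hα s (l t) g) := by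
  classical
  induction s using Finset.induction_on with
  | empty => simpa only [conv_empty, sum_empty] using const g
  | insert i s hi ih =>
    have := (gam hα (fun t => hl t i) (fun t => hd t i) (hc i)).mul ih
    simp only [conv_insert hα _ hi]
    convert this using 2 with t
    rw [sum_insert hi, mul_sum]
    congr 1
    · rw [smul_mul_assoc, sub_mul, mul_assoc]
    · refine sum_congr rfl fun j _ => ?_
      rw [mul_smul_comm, mul_sub, mul_left_comm]

end HasParamDeriv

/-- The derivative of the convolution `conv s (1 / θ) 1` along a path of weights. -/
theorem hasDerivAt_conv_unitStep {α : ℝ} (hα : 1 ≤ α) {ι : Type*} (s : Finset ι)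
    {θ θ' : ℝ → ι → ℝ} (hθ : ∀ t i, 0 < θ t i) (hd : ∀ t i, HasDerivAt (fun t => θ t i) (θ' t i) t)
    (hc : ∀ i, Continuous fun t => θ' t i) (t x : ℝ) :
    HasDerivAt (fun t => conv hα s (fun i => (θ t i)⁻¹) unitStep x)
      (-α * ∑ i ∈ s, θ' t i * conv hα s (fun i => (θ t i)⁻¹) (expo (θ t i)⁻¹) x) t := by
  have hθc (i : ι) : Continuous fun t => θ t i :=
    continuous_iff_continuousAt.2 fun t => (hd t i).continuousAt
  have key := (HasParamDeriv.conv hα s (l := fun t i => (θ t i)⁻¹)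
    (l' := fun t i => -θ' t i / θ t i ^ 2) (fun t i => inv_pos.2 (hθ t i))
    (fun t i => (hd t i).inv (hθ t i).ne')
    (fun i => (hc i).neg.div ((hθc i).pow 2) fun t => (pow_pos (hθ t i) 2).ne') unitStep).deriv t x
  refine key.congr_deriv ?_
  have happ : ∀ (s : Finset ι) (K : ι → Volterra), (∑ i ∈ s, K i) x = ∑ i ∈ s, K i x := by
    classical
    intro s K
    induction s using Finset.induction_on with
    | empty => simp
    | insert i s hi ih => rw [sum_insert hi, sum_insert hi, add_apply, ih]
  rw [happ, mul_sum]
  refine sum_congr rfl fun i _ => ?_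
  rw [← conv_mul_left, ← conv_sub]
  -- Applied to the constant `1`, the operator `l (1 - expo l)` gives `expo l`.
  have e : conv hα s (fun i => (θ t i)⁻¹) (expo (θ t i)⁻¹) = (θ t i)⁻¹ •
      conv hα s (fun i => (θ t i)⁻¹) (unitStep - expo (θ t i)⁻¹ * unitStep) := by
    rw [← conv_smul, smul_unitStep_sub]
  rw [e, smul_apply, smul_apply]
  have := hθ t i
  field_simp

end Volterra

/-! ### The distribution function as a convolution. -/

namespace Volterra

variable {α : ℝ} (hα : 1 ≤ α)

theorem conv_univ_succ {n : ℕ} (l : Fin (n + 1) → ℝ) (g : Volterra) :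
    conv hα univ l g = gam hα (l 0) * conv hα univ (fun i : Fin n => l i.succ) g := by
  rw [← inr_inj, inr_conv, Unitization.inr_mul, inr_conv, gamProd, Fin.prod_univ_succ, mul_assoc,
    gamProd]

theorem conv_unitStep_nonneg {ι : Type*} {s : Finset ι} {l : ι → ℝ} (hl : ∀ i ∈ s, 0 < l i)
    {x : ℝ} (hx : 0 ≤ x) : 0 ≤ conv hα s l unitStep x := by
  have h (y : ℝ) (hy : 0 < y) : 0 < conv hα s l unitStep y :=
    conv_pos hα hl (r := y + 1) (fun _ _ _ => one_pos) y hy (by linarith)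
  rcases hx.eq_or_lt with rfl | hx
  · have h1 : Filter.Tendsto (conv hα s l unitStep) (nhdsWithin 0 (Set.Ioi 0))
        (nhds (conv hα s l unitStep 0)) :=
      (Volterra.continuous _).continuousAt.tendsto.mono_left nhdsWithin_le_nhds
    refine ge_of_tendsto h1 ?_
    filter_upwards [self_mem_nhdsWithin] with z hz using (h z hz).le
  · exact (h x hx).le

theorem gammaPDF_eq_gam {x : ℝ} (hx : 0 ≤ x) : gammaPDF α 1 x = ENNReal.ofReal (gam hα 1 x) := by
  rw [gammaPDF_of_nonneg hx, gam_apply]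

theorem gam_inv_scale {c : ℝ} (hc : 0 < c) {x : ℝ} (hx : 0 ≤ x) :
    c * gam hα c⁻¹ (c * x) = gam hα 1 x := by
  rw [gam_apply, gam_apply, Real.mul_rpow hc.le hx, Real.inv_rpow hc.le, Real.rpow_sub_one hc.ne',
    inv_mul_cancel_left₀ hc.ne', Real.one_rpow, one_mul]
  have := Real.rpow_pos_of_pos hc α
  field_simp

/-- Adds one independent summand `c * X` to a sum with distribution function `F`. The conditionals
cut functions off on the negative axis, where elements of `Volterra` need not vanish; the
substitution `t = c a` produces the rate `c⁻¹`. -/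
theorem lintegral_gammaMeasure_ite {c x : ℝ} (hc : 0 < c) {F : Volterra}
    (hF : ∀ y, 0 ≤ y → 0 ≤ F y) :
    ∫⁻ a, ENNReal.ofReal (if 0 ≤ x - c * a then F (x - c * a) else 0) ∂(gammaMeasure α 1)
      = ENNReal.ofReal (if 0 ≤ x then (gam hα c⁻¹ * F) x else 0) := by
  have hmeas : Measurable fun a : ℝ =>
      ENNReal.ofReal (if 0 ≤ x - c * a then F (x - c * a) else 0) := by
    refine ENNReal.measurable_ofReal.comp (Measurable.ite ?_ ?_ measurable_const)
    · exact measurableSet_le measurable_const (by fun_prop)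
    · exact Continuous.measurable (by fun_prop)
  have hpdf : Measurable (gammaPDF α 1) :=
    ENNReal.measurable_ofReal.comp (measurable_gammaPDFReal α 1)
  rw [gammaMeasure, lintegral_withDensity_eq_lintegral_mul _ hpdf hmeas]
  split_ifs with hx
  · have h1 : ∀ a, (gammaPDF α 1 * fun a => ENNReal.ofReal
        (if 0 ≤ x - c * a then F (x - c * a) else 0)) a
        = (Set.Icc 0 (x / c)).indicator
          (fun a => ENNReal.ofReal (gam hα 1 a * F (x - c * a))) a := by
      intro a
      simp only [Pi.mul_apply]
      rcases lt_or_ge a 0 with ha | ha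
      · rw [gammaPDF_of_neg ha, zero_mul, Set.indicator_of_notMem (fun h => ha.not_ge h.1)]
      · by_cases hax : a ≤ x / c
        · have h2 : 0 ≤ x - c * a := by rw [le_div_iff₀ hc] at hax; linarith
          rw [if_pos h2, Set.indicator_of_mem (show a ∈ Set.Icc 0 (x / c) from ⟨ha, hax⟩), gammaPDF_eq_gam hα ha,
            ENNReal.ofReal_mul (gam_nonneg hα one_pos ha)]
        · have h2 : ¬ 0 ≤ x - c * a := by
            rw [le_div_iff₀ hc] at hax; intro h; exact hax (by linarith)
          rw [if_neg h2, ENNReal.ofReal_zero, mul_zero, Set.indicator_of_notMem fun h => hax h.2]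
    rw [lintegral_congr h1, lintegral_indicator measurableSet_Icc,
      ← ofReal_integral_eq_lintegral_ofReal]
    · congr 1
      have hxc : 0 ≤ x / c := div_nonneg hx hc.le
      rw [integral_Icc_eq_integral_Ioc, ← intervalIntegral.integral_of_le hxc, mul_apply']
      have h3 := intervalIntegral.mul_integral_comp_mul_left (a := 0) (b := x / c)
        (f := fun t => gam hα c⁻¹ t * F (x - t)) c
      rw [mul_zero, mul_div_cancel₀ _ hc.ne'] at h3
      rw [← h3, ← intervalIntegral.integral_const_mul]
      refine intervalIntegral.integral_congr fun t ht => ?_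
      rw [Set.uIcc_of_le hxc] at ht
      rw [← gam_inv_scale hα hc ht.1, mul_assoc]
    · exact (Continuous.continuousOn (by fun_prop)).integrableOn_Icc
    · refine (ae_restrict_iff' measurableSet_Icc).2 (Filter.Eventually.of_forall fun a ha => ?_)
      refine mul_nonneg (gam_nonneg hα one_pos ha.1) (hF _ ?_)
      have := ha.2
      rw [le_div_iff₀ hc] at this; linarith
  · rw [ENNReal.ofReal_zero]
    refine (lintegral_congr fun a => ?_).trans lintegral_zero
    simp only [Pi.mul_apply]
    rcases lt_or_ge a 0 with ha | ha
    · rw [gammaPDF_of_neg ha, zero_mul]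
    · have h2 : ¬ 0 ≤ x - c * a := fun h => hx (by nlinarith)
      rw [if_neg h2, ENNReal.ofReal_zero, mul_zero]

theorem isProbabilityMeasure_gammaMeasure_one {α : ℝ} (hα : 1 ≤ α) :
    IsProbabilityMeasure (gammaMeasure α 1) :=
  isProbabilityMeasure_gammaMeasure (by linarith) one_pos

theorem gammaSumLaw_Iic {n : ℕ} (θ : Fin n → ℝ) (hθ : ∀ i, 0 < θ i) (x : ℝ) :
    gammaSumLaw α θ (Set.Iic x)
      = ENNReal.ofReal (if 0 ≤ x then conv hα univ (fun i => (θ i)⁻¹) unitStep x else 0) := by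
  have := isProbabilityMeasure_gammaMeasure_one hα
  have hmeas {n : ℕ} (θ : Fin n → ℝ) : Measurable fun y : Fin n → ℝ => ∑ i, θ i * y i := by
    fun_prop
  induction n generalizing x with
  | zero =>
    rw [gammaSumLaw, Measure.map_apply (hmeas θ) measurableSet_Iic, univ_eq_empty, conv_empty]
    simp only [sum_empty, unitStep_apply]
    split_ifs with h
    · have : (fun _ : Fin 0 → ℝ => (0 : ℝ)) ⁻¹' Set.Iic x = Set.univ := by ext; simp [h]
      rw [this, measure_univ, ENNReal.ofReal_one]
    · have : (fun _ : Fin 0 → ℝ => (0 : ℝ)) ⁻¹' Set.Iic x = ∅ := by ext; simp at h; simp [h]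
      rw [this, measure_empty, ENNReal.ofReal_zero]
  | succ n ih =>
    have hmp := (measurePreserving_piFinSuccAbove
      (fun _ : Fin (n + 1) => gammaMeasure α 1) 0).symm
    rw [gammaSumLaw, Measure.map_apply (hmeas θ) measurableSet_Iic,
      ← hmp.measure_preimage_equiv, Measure.prod_apply
        ((MeasurableEquiv.measurable _) (hmeas θ measurableSet_Iic)), conv_univ_succ,
      ← lintegral_gammaMeasure_ite hα (hθ 0) fun y hy => conv_unitStep_nonneg hα
        (fun i _ => inv_pos.2 (hθ i.succ)) hy]
    refine lintegral_congr fun a => ?_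
    rw [← ih (fun i => θ i.succ) (fun i => hθ i.succ), gammaSumLaw,
      Measure.map_apply (hmeas _) measurableSet_Iic]
    congr 1
    ext y
    simp [MeasurableEquiv.piFinSuccAbove_symm_apply, Fin.insertNthEquiv, Fin.sum_univ_succ,
      le_sub_iff_add_le, add_comm]

theorem gammaSumCDF_eq {n : ℕ} (θ : Fin n → ℝ) (hθ : ∀ i, 0 < θ i) {x : ℝ} (hx : 0 ≤ x) :
    gammaSumCDF α θ x = conv hα univ (fun i => (θ i)⁻¹) unitStep x := by
  have := isProbabilityMeasure_gammaMeasure_one hα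
  have : IsProbabilityMeasure (gammaSumLaw α θ) :=
    Measure.isProbabilityMeasure_map (Measurable.aemeasurable (by fun_prop))
  rw [gammaSumCDF, cdf_eq_real, measureReal_def, gammaSumLaw_Iic hα θ hθ, if_pos hx,
    ENNReal.toReal_ofReal (conv_unitStep_nonneg hα (fun i _ => inv_pos.2 (hθ i)) hx)]

end Volterra

/-! ### From pairs of functions to averages. -/

/-- Each index with `d m ≠ 0` bounds `μ` on one side by `-d' m / d m`. A lower and an upper bound
are compatible by the hypothesis for the combination that cancels `d`, so pairs suffice. -/
theorem exists_forall_add_mul_neg {ι : Type*} (M : Finset ι) (d d' : ι → ℝ)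
    (h : ∀ m ∈ M, ∀ m' ∈ M, ∀ k k' : ℝ, 0 ≤ k → 0 ≤ k' → 0 < k + k' →
      k * d m + k' * d m' = 0 → k * d' m + k' * d' m' < 0) :
    ∃ μ : ℝ, ∀ m ∈ M, d' m + μ * d m < 0 := by
  classical
  obtain ⟨μ, h1, h2⟩ := Order.exists_between_finsets
    ((M.filter fun m => d m < 0).image fun m => -d' m / d m)
    ((M.filter fun m => 0 < d m).image fun m => -d' m / d m) (by
      intro x hx y hy
      obtain ⟨m, hm, rfl⟩ := mem_image.1 hx
      obtain ⟨m', hm', rfl⟩ := mem_image.1 hy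
      rw [mem_filter] at hm hm'
      have := h m hm.1 m' hm'.1 (d m') (-d m) hm'.2.le (by linarith [hm.2]) (by linarith [hm.2, hm'.2])
        (by ring)
      rw [lt_div_iff₀ hm'.2, div_mul_eq_mul_div, div_lt_iff_of_neg hm.2]
      linarith)
  refine ⟨μ, fun m hm => ?_⟩
  rcases lt_trichotomy (d m) 0 with hd | hd | hd
  · have := h1 _ (mem_image_of_mem _ (mem_filter.2 ⟨hm, hd⟩))
    rw [div_lt_iff_of_neg hd] at this
    linarith
  · have := h m hm m hm 1 0 zero_le_one le_rfl (by norm_num) (by rw [hd]; ring)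
    rw [hd]
    linarith
  · have := h2 _ (mem_image_of_mem _ (mem_filter.2 ⟨hm, hd⟩))
    rw [lt_div_iff₀ hd] at this
    linarith

/-- A function that is locally strictly decreasing up to an exponential factor crosses down. -/
theorem neg_of_locally_exp_mul_strictAnti {Δ : ℝ → ℝ} {x y : ℝ} (hxy : x < y) (hx : Δ x ≤ 0)
    (h : ∀ z ∈ Set.Icc x y, ∃ r > 0, ∃ μ : ℝ, ∀ v w, z - r < v → v < w → w < z + r → x ≤ v →
      Real.exp (μ * w) * Δ w < Real.exp (μ * v) * Δ v) : Δ y < 0 := by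
  have step : ∀ z ∈ Set.Icc x y, ∃ r > 0, ∀ v w, z - r < v → v < w → w < z + r → x ≤ v →
      Δ v ≤ 0 → Δ w < 0 := by
    intro z hz
    obtain ⟨r, hr, μ, hμ⟩ := h z hz
    refine ⟨r, hr, fun v w h1 h2 h3 h4 h5 => ?_⟩
    have := hμ v w h1 h2 h3 h4
    by_contra hw
    have e1 := mul_nonneg (Real.exp_pos (μ * w)).le (not_lt.1 hw)
    have e2 := mul_nonpos_of_nonneg_of_nonpos (Real.exp_pos (μ * v)).le h5
    linarith
  set S := {z | z ∈ Set.Icc x y ∧ ∀ w, x < w → w ≤ z → Δ w < 0}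
  have hxS : x ∈ S := ⟨⟨le_rfl, hxy.le⟩, fun w h1 h2 => absurd h1 (not_lt.2 h2)⟩
  have hb : BddAbove S := ⟨y, fun z hz => hz.1.2⟩
  set s := sSup S
  have hxs : x ≤ s := le_csSup hb hxS
  have hsy : s ≤ y := csSup_le ⟨x, hxS⟩ fun z hz => hz.1.2
  obtain ⟨r, hr, hstep⟩ := step s ⟨hxs, hsy⟩
  have hlt : ∀ w, x < w → w < s → Δ w < 0 := fun w h1 h2 => by
    obtain ⟨z, hz, hwz⟩ := exists_lt_of_lt_csSup ⟨x, hxS⟩ h2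
    exact hz.2 w h1 hwz.le
  have hs : x < s → Δ s < 0 := fun hxs' => by
    obtain ⟨w, hw1, hw2⟩ := exists_between (max_lt hxs' (show s - r < s by linarith))
    exact hstep w s ((le_max_right _ _).trans_lt hw1) hw2 (by linarith)
      ((le_max_left _ _).trans hw1.le) (hlt w ((le_max_left _ _).trans_lt hw1) hw2).le
  have hs0 : Δ s ≤ 0 := by
    rcases hxs.eq_or_lt with h1 | h1
    · rwa [← h1]
    · exact (hs h1).le
  have hsy' : s = y := by
    by_contra hne
    have hsy' := lt_of_le_of_ne hsy hne
    have hm : min (s + r / 2) y ∈ S := by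
      refine ⟨⟨le_min (by linarith) hxy.le, min_le_right _ _⟩, fun w h1 h2 => ?_⟩
      rcases lt_trichotomy w s with h3 | h3 | h3
      · exact hlt w h1 h3
      · rw [h3]; exact hs (h3 ▸ h1)
      · exact hstep s w (by linarith) h3 (by linarith [h2.trans (min_le_left _ _)]) hxs hs0
    have := le_csSup hb hm
    exact absurd this (not_le.2 (lt_min (by linarith) hsy'))
  rw [← hsy']
  exact hs (by rw [hsy']; exact hxy)

namespace Volterra

theorem exists_nhds_exp_mul_strictAnti {P ι : Type*} [TopologicalSpace P] {M : Finset ι}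
    {D D' : ι → P → Volterra} (hD : ∀ m, JointlyContinuous (D m))
    (hD' : ∀ m, JointlyContinuous (D' m)) (hd : ∀ m p x, HasDerivAt (D m p) (D' m p x) x) {p₀ : P}
    {z : ℝ} (hpair : ∀ m ∈ M, ∀ m' ∈ M, ∀ k k' : ℝ, 0 ≤ k → 0 ≤ k' → 0 < k + k' →
      k * D m p₀ z + k' * D m' p₀ z = 0 → k * D' m p₀ z + k' * D' m' p₀ z < 0) :
    ∃ N ∈ nhds p₀, ∃ r > 0, ∃ μ : ℝ, ∀ p ∈ N, ∀ m ∈ M, ∀ v w, z - r < v → v < w → w < z + r →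
      Real.exp (μ * w) * D m p w < Real.exp (μ * v) * D m p v := by
  obtain ⟨μ, hμ⟩ := exists_forall_add_mul_neg M (fun m => D m p₀ z) (fun m => D' m p₀ z) hpair
  have h1 : ∀ᶠ q : P × ℝ in nhds (p₀, z), ∀ m ∈ M, D' m q.1 q.2 + μ * D m q.1 q.2 < 0 := by
    rw [Filter.eventually_all_finset]
    intro m hm
    have hc : Continuous fun q : P × ℝ => D' m q.1 q.2 + μ * D m q.1 q.2 :=
      Continuous.add (hD' m) (continuous_const.mul (hD m))
    exact hc.continuousAt.eventually_lt continuousAt_const (hμ m hm)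
  obtain ⟨N, hN, V, hV, hNV⟩ := mem_nhds_prod_iff.1 h1
  obtain ⟨r, hr, hrV⟩ := Metric.mem_nhds_iff.1 hV
  refine ⟨N, hN, r, hr, μ, fun p hp m hm v w hv hvw hw => ?_⟩
  have hder (x : ℝ) : HasDerivAt (fun x => Real.exp (μ * x) * D m p x)
      (Real.exp (μ * x) * (μ * 1) * D m p x + Real.exp (μ * x) * D' m p x) x :=
    (((hasDerivAt_id x).const_mul μ).exp).mul (hd m p x)
  have hanti : StrictAntiOn (fun x => Real.exp (μ * x) * D m p x) (Set.Icc v w) := by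
    refine strictAntiOn_of_deriv_neg (convex_Icc v w)
      (fun x _ => (hder x).continuousAt.continuousWithinAt) fun x hx => ?_
    rw [interior_Icc] at hx
    have hmem : (p, x) ∈ N ×ˢ V := ⟨hp, hrV (by
      rw [Metric.mem_ball, Real.dist_eq, abs_lt]; constructor <;> linarith [hx.1, hx.2])⟩
    have h2 := mul_neg_of_pos_of_neg (Real.exp_pos (μ * x)) (hNV hmem m hm)
    rw [(hder x).deriv]
    simp only at h2
    linarith
  exact hanti (Set.left_mem_Icc.2 hvw.le) (Set.right_mem_Icc.2 hvw.le) hvw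

/-- If near `p₀` the functions `D m p` are positive near `0`, negative near `∞`, and at `p₀` all
nonnegative combinations of two of them cross zero downwards, then every average of the functions
`D m p`, for `p` close to `p₀`, has exactly one zero. -/
theorem exists_nhds_forall_average {P ι : Type*} [TopologicalSpace P] {M : Finset ι}
    {D D' : ι → P → Volterra} (hD : ∀ m, JointlyContinuous (D m))
    (hD' : ∀ m, JointlyContinuous (D' m)) (hd : ∀ m p x, HasDerivAt (D m p) (D' m p x) x) {p₀ : P}
    (hpair : ∀ z, 0 < z → ∀ m ∈ M, ∀ m' ∈ M, ∀ k k' : ℝ, 0 ≤ k → 0 ≤ k' → 0 < k + k' →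
      k * D m p₀ z + k' * D m' p₀ z = 0 → k * D' m p₀ z + k' * D' m' p₀ z < 0)
    {a b : ℝ} (ha : 0 < a)
    (hpos : ∀ᶠ p in nhds p₀, ∀ m ∈ M, ∀ x, 0 < x → x ≤ a → 0 < D m p x)
    (hneg : ∀ᶠ p in nhds p₀, ∀ m ∈ M, ∀ x, b ≤ x → D m p x < 0) :
    ∃ N ∈ nhds p₀, ∀ Δ : ℝ → ℝ, Continuous Δ →
      (∀ x y s t : ℝ, 0 < x → 0 < y → (∀ p ∈ N, ∀ m ∈ M, 0 < s * D m p x + t * D m p y) →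
        0 < s * Δ x + t * Δ y) →
      ∃ x₀, 0 < x₀ ∧ (∀ x, 0 < x → x < x₀ → 0 < Δ x) ∧ ∀ x, x₀ < x → Δ x < 0 := by
  -- The exponent `μ` depends on the point `z`; finitely many points are enough to cover `[a, b]`.
  choose! N hN r hr μ hμ using fun z (hz : 0 < z) =>
    exists_nhds_exp_mul_strictAnti hD hD' hd (hpair z hz)
  obtain ⟨T, hT, hcover⟩ := (isCompact_Icc (a := a) (b := b)).elim_nhds_subcover
    (fun z => Metric.ball z (r z)) fun z hz => Metric.ball_mem_nhds z (hr z (ha.trans_le hz.1))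
  refine ⟨_, Filter.inter_mem (Filter.inter_mem hpos hneg) ((Filter.biInter_finset_mem T).2
    fun z hz => hN z (ha.trans_le (hT z hz).1)), fun Δ hΔc hΔ => ?_⟩
  have hΔpos (x : ℝ) (hx : 0 < x) (hxa : x ≤ a) : 0 < Δ x := by
    have := hΔ x x 1 0 hx hx fun p hp m hm => by
      have := hp.1.1 m hm x hx hxa
      linarith
    linarith
  have hΔneg (x : ℝ) (hx : 0 < x) (hbx : b ≤ x) : Δ x < 0 := by
    have := hΔ x x (-1) 0 hx hx fun p hp m hm => by
      have := hp.1.2 m hm x hbx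
      linarith
    linarith
  have hcross : CrossesDown Δ := by
    intro x y hx hxy hΔx
    have hax : a < x := by
      by_contra h
      exact absurd (hΔpos x hx (not_lt.1 h)) (not_lt.2 hΔx)
    rcases le_or_gt b y with hby | hby
    · exact hΔneg y (hx.trans hxy) hby
    refine neg_of_locally_exp_mul_strictAnti hxy hΔx fun z hz => ?_
    obtain ⟨c, hcT, hzc⟩ := Set.mem_iUnion₂.1
      (hcover (show z ∈ Set.Icc a b from ⟨hax.le.trans hz.1, hz.2.trans hby.le⟩))
    rw [Metric.mem_ball, Real.dist_eq] at hzc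
    have hzc' := abs_lt.1 hzc
    refine ⟨r c - |z - c|, by linarith, μ c, fun v w h1 h2 h3 h4 => ?_⟩
    have hc0 : 0 < c := ha.trans_le (hT c hcT).1
    have hab := abs_le.1 (le_refl |z - c|)
    -- With these weights the two-point inequality says that `exp (μ x) Δ x` is strictly smaller at
    -- `w` than at `v`.
    have := hΔ v w (Real.exp (μ c * v)) (-Real.exp (μ c * w)) (by linarith) (by linarith)
      fun p hp m hm => by
        have := hμ c hc0 p (Set.mem_iInter₂.1 hp.2 c hcT) m hm v w (by linarith) h2 (by linarith)
        linarith
    linarith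
  have hb0 : 0 < max a b := ha.trans_le (le_max_left _ _)
  obtain ⟨x₀, hx₀, hzero⟩ := intermediate_value_Icc' (le_max_left a b) hΔc.continuousOn
    (show (0 : ℝ) ∈ Set.Icc (Δ (max a b)) (Δ a) from
      ⟨(hΔneg _ hb0 (le_max_right _ _)).le, (hΔpos a ha le_rfl).le⟩)
  have hx₀0 : 0 < x₀ := ha.trans_le hx₀.1
  refine ⟨x₀, hx₀0, fun x hx hxx => ?_, fun x hx => hcross hx₀0 hx hzero.le⟩
  by_contra h
  exact absurd (hcross hx hxx (not_lt.1 h)) (by rw [hzero]; exact lt_irrefl 0)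

/-! ### The functions being averaged. -/

section generators

variable {α : ℝ} (hα : 1 ≤ α) {ι : Type*} [Fintype ι]

/-- Up to the factor `α`, the difference of the derivatives of the distribution function with
respect to the weights `1 / l j` and `1 / l i`. -/
noncomputable def genDiff (i j : ι) (l : ι → ℝ) : Volterra :=
  conv hα univ l (expo (l i) - expo (l j))

/-- The derivative of `genDiff`. -/
noncomputable def genDiffDeriv [DecidableEq ι] (i j : ι) (l : ι → ℝ) : Volterra :=
  let f := conv hα (univ.erase i) l (gam hα (l i))
  l i • (f - expo (l i) * f) - l j • (f - expo (l j) * f)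

theorem jointlyContinuous_genDiff (i j : ι) : JointlyContinuous (genDiff hα i j) :=
  JointlyContinuous.conv hα univ (fun i => continuous_apply i)
    ((JointlyContinuous.expo (continuous_apply i)).sub (JointlyContinuous.expo (continuous_apply j)))

theorem jointlyContinuous_genDiffDeriv [DecidableEq ι] (i j : ι) : JointlyContinuous (genDiffDeriv hα i j) := by
  have hf : JointlyContinuous fun l : ι → ℝ => conv hα (univ.erase i) l (gam hα (l i)) :=
    JointlyContinuous.conv hα _ (fun i => continuous_apply i)
      (JointlyContinuous.gam hα (continuous_apply i))
  exact ((hf.sub ((JointlyContinuous.expo (continuous_apply i)).mul hf)).smul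
    (continuous_apply i)).sub
    ((hf.sub ((JointlyContinuous.expo (continuous_apply j)).mul hf)).smul (continuous_apply j))

theorem hasDerivAt_genDiff [DecidableEq ι] (i j : ι) (l : ι → ℝ) (x : ℝ) :
    HasDerivAt (genDiff hα i j l) (genDiffDeriv hα i j l x) x := by
  set f := conv hα (univ.erase i) l (gam hα (l i)) with hf
  have e : genDiff hα i j l = expo (l i) * f - expo (l j) * f := by
    -- Splitting off one gamma factor writes the function as exponential densities convolved with a
    -- fixed `f`, which can be differentiated.
    rw [genDiff, conv_erase hα l (mem_univ i), mul_comm, conv_mul_left, ← hf, sub_mul]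
  rw [e]
  exact (hasDerivAt_expo_mul (l i) f x).sub (hasDerivAt_expo_mul (l j) f x)

theorem genDiff_eq_left {i j : ι} {l : ι → ℝ} (hj : 0 < l j) :
    genDiff hα i j l = ((l i - l j) / l j) • conv hα univ l (gen (l j) (l i)) := by
  rw [genDiff, ← conv_smul, div_eq_inv_mul, ← smul_smul, sub_smul_gen, smul_smul,
    inv_mul_cancel₀ hj.ne', one_smul]

theorem genDiff_eq_right {i j : ι} {l : ι → ℝ} (hi : 0 < l i) :
    genDiff hα i j l = ((l i - l j) / l i) • conv hα univ l (gen (l i) (l j)) := by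
  rw [genDiff, ← conv_smul, div_eq_inv_mul, ← smul_smul, ← neg_sub (l j), neg_smul, sub_smul_gen,
    smul_neg, smul_smul, inv_mul_cancel₀ hi.ne', one_smul, neg_sub]

theorem crossesDown_genDiff {i j : ι} {l : ι → ℝ} (hl : ∀ i, 0 < l i) (hij : l j < l i) :
    CrossesDown (genDiff hα i j l) := by
  rw [genDiff_eq_left hα (hl j)]
  refine (crossesDown_conv hα (fun i _ => hl i) (crossesDown_gen (hl j) hij)).of_pos_mul
    (w := fun _ => (l i - l j) / l j) (fun x _ => div_pos (by linarith) (hl j)) fun x _ => rfl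

theorem exists_genDiff_neg {i j : ι} {l : ι → ℝ} (hl : ∀ i, 0 < l i) (hij : l j < l i) :
    ∃ x, 0 < x ∧ genDiff hα i j l x < 0 := by
  obtain ⟨x, hx, h⟩ := exists_conv_gen_neg hα (s := univ) (fun i _ => hl i) (hl j) hij
  refine ⟨x, hx, ?_⟩
  rw [genDiff_eq_left hα (hl j)]
  exact mul_neg_of_pos_of_neg (div_pos (by linarith) (hl j)) h

variable {M : Finset ι} {u v : ι → ι} {l₀ : ι → ℝ}

theorem eventually_pos_and_lt (hl : ∀ i, 0 < l₀ i) (huv : ∀ m ∈ M, l₀ (v m) < l₀ (u m)) :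
    ∀ᶠ l in nhds l₀, (∀ i, 0 < l i) ∧ ∀ m ∈ M, l (v m) < l (u m) := by
  refine Filter.Eventually.and ?_ ?_
  · rw [Filter.eventually_all]
    exact fun i => continuousAt_const.eventually_lt (continuous_apply i).continuousAt (hl i)
  · rw [Filter.eventually_all_finset]
    exact fun m hm => (continuous_apply (v m)).continuousAt.eventually_lt
      (continuous_apply (u m)).continuousAt (huv m hm)

/-- At `0` the difference of exponential densities is `l (u m) - l (v m) > 0`. It stays positive
jointly near `(l₀, 0)`, and convolution with positive densities keeps positivity on an initial
interval. -/
theorem eventually_genDiff_pos (hl : ∀ i, 0 < l₀ i) (huv : ∀ m ∈ M, l₀ (v m) < l₀ (u m)) :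
    ∃ a, 0 < a ∧ ∀ᶠ l in nhds l₀, ∀ m ∈ M, ∀ x, 0 < x → x ≤ a → 0 < genDiff hα (u m) (v m) l x := by
  have h1 : ∀ᶠ q : (ι → ℝ) × ℝ in nhds (l₀, 0), ∀ m ∈ M,
      0 < (expo (q.1 (u m)) - expo (q.1 (v m)) : Volterra) q.2 := by
    rw [Filter.eventually_all_finset]
    intro m hm
    have hc : JointlyContinuous fun l : ι → ℝ => expo (l (u m)) - expo (l (v m)) :=
      (JointlyContinuous.expo (continuous_apply _)).sub (JointlyContinuous.expo (continuous_apply _))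
    refine continuousAt_const.eventually_lt (Continuous.continuousAt hc) ?_
    simpa [expo_apply] using huv m hm
  obtain ⟨N, hN, V, hV, hNV⟩ := mem_nhds_prod_iff.1 h1
  obtain ⟨r, hr, hrV⟩ := Metric.mem_nhds_iff.1 hV
  refine ⟨r / 2, half_pos hr, ?_⟩
  filter_upwards [hN, eventually_pos_and_lt hl huv] with l hlN hl m hm x hx hxr
  refine conv_pos hα (fun i _ => hl.1 i) (r := r) (fun y hy hyr => ?_) x hx (by linarith)
  have : (l, y) ∈ N ×ˢ V := ⟨hlN, hrV (by
    rw [Metric.mem_ball, Real.dist_eq, abs_lt]; constructor <;> linarith)⟩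
  exact hNV this m hm

/-- Negativity at one point `b` is an open condition on the rates, and the crossing property carries
it to all larger arguments. -/
theorem eventually_genDiff_neg (hl : ∀ i, 0 < l₀ i) (huv : ∀ m ∈ M, l₀ (v m) < l₀ (u m)) :
    ∃ b, ∀ᶠ l in nhds l₀, ∀ m ∈ M, ∀ x, b ≤ x → genDiff hα (u m) (v m) l x < 0 := by
  choose! X hX0 hX using fun m (hm : m ∈ M) => exists_genDiff_neg hα hl (huv m hm)
  set b := 1 + ∑ m ∈ M, X m with hb
  have hXb (m : ι) (hm : m ∈ M) : X m < b := by
    have := single_le_sum (f := X) (fun i hi => (hX0 i hi).le) hm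
    linarith
  refine ⟨b, ?_⟩
  have h1 : ∀ᶠ l in nhds l₀, ∀ m ∈ M, genDiff hα (u m) (v m) l b < 0 := by
    rw [Filter.eventually_all_finset]
    intro m hm
    have hc : Continuous fun l : ι → ℝ => genDiff hα (u m) (v m) l b :=
      (jointlyContinuous_genDiff hα (u m) (v m)).comp (f := fun l : ι → ℝ => (l, b)) (by fun_prop)
    exact hc.continuousAt.eventually_lt continuousAt_const
      (crossesDown_genDiff hα hl (huv m hm) (hX0 m hm) (hXb m hm) (hX m hm).le)
  filter_upwards [h1, eventually_pos_and_lt hl huv] with l h1 h2 m hm x hx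
  rcases hx.eq_or_lt with rfl | hx
  · exact h1 m hm
  · exact crossesDown_genDiff hα h2.1 (h2.2 m hm) ((hX0 m hm).trans (hXb m hm)) hx (h1 m hm).le

theorem pair_deriv_neg [DecidableEq ι] {i j i' j' : ι} {l : ι → ℝ} {k k' b : ℝ} {W : Volterra} (hb : 0 < b)
    (hW : CrossesDown W) (h : k • genDiff hα i j l + k' • genDiff hα i' j' l = expo b * W) {z : ℝ}
    (hz : 0 < z) (hzero : k * genDiff hα i j l z + k' * genDiff hα i' j' l z = 0) :
    k * genDiffDeriv hα i j l z + k' * genDiffDeriv hα i' j' l z < 0 := by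
  have h1 := ((hasDerivAt_genDiff hα i j l z).const_mul k).add
    ((hasDerivAt_genDiff hα i' j' l z).const_mul k')
  have h2 := deriv_neg_of_eq_expo_mul hb hW h hz hzero
  rwa [show deriv (k • genDiff hα i j l + k' • genDiff hα i' j' l : Volterra) z = _ from
    h1.deriv] at h2

end generators

end Volterra

/-! ### Pairs of generators, and integration along the segment. -/

namespace Volterra

section pairs

variable {α : ℝ} (hα : 1 ≤ α) {ι : Type*} [Fintype ι] [DecidableEq ι] {l : ι → ℝ}

theorem mul_add_mul_pos {k k' c c' : ℝ} (hk : 0 ≤ k) (hk' : 0 ≤ k') (hkk : 0 < k + k')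
    (hc : 0 < c) (hc' : 0 < c') : 0 < k * c + k' * c' := by
  rcases hk.eq_or_lt with rfl | hk
  · rw [zero_mul, zero_add]
    exact mul_pos (by linarith) hc'
  · exact add_pos_of_pos_of_nonneg (mul_pos hk hc) (mul_nonneg hk' hc'.le)

theorem genDiffDeriv_pair_left (hl : ∀ i, 0 < l i) {i i' j : ι} (hi : l j < l i) (hi' : l j < l i')
    {k k' : ℝ} (hk : 0 ≤ k) (hk' : 0 ≤ k') (hkk : 0 < k + k') {z : ℝ} (hz : 0 < z)
    (hzero : k * genDiff hα i j l z + k' * genDiff hα i' j l z = 0) :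
    k * genDiffDeriv hα i j l z + k' * genDiffDeriv hα i' j l z < 0 := by
  have hc : 0 < (l i - l j) / l j := div_pos (by linarith) (hl j)
  have hc' : 0 < (l i' - l j) / l j := div_pos (by linarith) (hl j)
  obtain ⟨W, hW, h⟩ := conv_gen_same hα (s := univ) (fun i _ => hl i) ⟨j, mem_univ j⟩ (b := l j)
    (hl i) (hl i') (mul_nonneg hk hc.le) (mul_nonneg hk' hc'.le) (mul_add_mul_pos hk hk' hkk hc hc')
  refine pair_deriv_neg hα (hl j) hW ?_ hz hzero
  rw [genDiff_eq_left hα (hl j), genDiff_eq_left hα (hl j), smul_smul, smul_smul, h]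

theorem genDiffDeriv_pair_right (hl : ∀ i, 0 < l i) {i j j' : ι} (hj : l j < l i) (hj' : l j' < l i)
    {k k' : ℝ} (hk : 0 ≤ k) (hk' : 0 ≤ k') (hkk : 0 < k + k') {z : ℝ} (hz : 0 < z)
    (hzero : k * genDiff hα i j l z + k' * genDiff hα i j' l z = 0) :
    k * genDiffDeriv hα i j l z + k' * genDiffDeriv hα i j' l z < 0 := by
  have hc : 0 < (l i - l j) / l i := div_pos (by linarith) (hl i)
  have hc' : 0 < (l i - l j') / l i := div_pos (by linarith) (hl i)
  obtain ⟨W, hW, h⟩ := conv_gen_same hα (s := univ) (fun i _ => hl i) ⟨j, mem_univ j⟩ (b := l i)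
    (hl j) (hl j') (mul_nonneg hk hc.le) (mul_nonneg hk' hc'.le) (mul_add_mul_pos hk hk' hkk hc hc')
  refine pair_deriv_neg hα (hl i) hW ?_ hz hzero
  rw [genDiff_eq_right hα (hl i), genDiff_eq_right hα (hl i), smul_smul, smul_smul, h]

theorem genDiffDeriv_pair_cross (hl : ∀ i, 0 < l i) {i j p q : ι} (hij : l j < l i)
    (hpq : l q < l p) (hjp : l p ≤ l j)
    {k k' : ℝ} (hk : 0 ≤ k) (hk' : 0 ≤ k') (hkk : 0 < k + k') {z : ℝ} (hz : 0 < z)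
    (hzero : k * genDiff hα i j l z + k' * genDiff hα p q l z = 0) :
    k * genDiffDeriv hα i j l z + k' * genDiffDeriv hα p q l z < 0 := by
  have hc : 0 < (l i - l j) / l j := div_pos (by linarith) (hl j)
  have hc' : 0 < (l p - l q) / l p := div_pos (by linarith) (hl p)
  obtain ⟨W, hW, h⟩ := conv_gen_cross hα (s := univ) (fun i _ => hl i) (mem_univ p) (mem_univ q)
    (fun h => hpq.ne (by rw [h])) hij hjp hpq (mul_nonneg hk hc.le) (mul_nonneg hk' hc'.le)
    (mul_add_mul_pos hk hk' hkk hc hc')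
  refine pair_deriv_neg hα (hl j) hW ?_ hz hzero
  rw [genDiff_eq_left hα (hl j), genDiff_eq_right hα (hl p), smul_smul, smul_smul, h]

end pairs

section path

variable {α : ℝ} (hα : 1 ≤ α) {ι : Type*} [Fintype ι] [DecidableEq ι]

/-- If `η - θ` is a positive combination of the vectors `e (u m) - e (v m)`, then the distribution
functions at `θ` and `η` differ by an average of the functions `genDiff` along the segment from `θ`
to `η`. -/
theorem conv_unitStep_sub_pos {M : Finset ι} (hM : M.Nonempty) {u v : ι → ι} {δ θ η : ι → ℝ}
    (hδ : ∀ m ∈ M, 0 < δ m)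
    (hη : ∀ i, η i - θ i =
      ∑ m ∈ M, δ m * ((if u m = i then 1 else 0) - (if v m = i then 1 else 0)))
    {N : Set (ι → ℝ)} (hθ : ∀ r ∈ Set.Icc (0 : ℝ) 1, (∀ i, 0 < θ i + r * (η i - θ i)) ∧
      (fun i => (θ i + r * (η i - θ i))⁻¹) ∈ N)
    {x y s t : ℝ} (h : ∀ l ∈ N, ∀ m ∈ M,
      0 < s * genDiff hα (u m) (v m) l x + t * genDiff hα (u m) (v m) l y) :
    0 < s * (conv hα univ (fun i => (θ i)⁻¹) unitStep - conv hα univ (fun i => (η i)⁻¹) unitStep) x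
      + t * (conv hα univ (fun i => (θ i)⁻¹) unitStep
        - conv hα univ (fun i => (η i)⁻¹) unitStep) y := by
  -- A smooth parameter on the whole line that stays in `[0, 1]`: the derivative formula needs
  -- weights that are positive for every real parameter. It runs from `0` to `1` on `[0, π]`, with
  -- positive speed inside.
  set r : ℝ → ℝ := fun τ => (1 - Real.cos τ) / 2 with hr
  have hr01 (τ : ℝ) : r τ ∈ Set.Icc (0 : ℝ) 1 := by
    constructor <;> simp only [hr] <;> linarith [Real.cos_le_one τ, Real.neg_one_le_cos τ]
  set p : ℝ → ι → ℝ := fun τ i => θ i + r τ * (η i - θ i) with hp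
  have hrd (τ : ℝ) : HasDerivAt r (Real.sin τ / 2) τ := by
    have := ((Real.hasDerivAt_cos τ).const_sub 1).div_const 2
    rwa [neg_neg] at this
  have hd (x τ : ℝ) := hasDerivAt_conv_unitStep hα univ (θ := p)
    (θ' := fun τ i => Real.sin τ / 2 * (η i - θ i)) (fun τ => (hθ _ (hr01 τ)).1)
    (fun τ i => ((hrd τ).mul_const _).const_add _) (fun i => by fun_prop) τ x
  have hsum (l : ι → ℝ) (c x : ℝ) :
      ∑ i, c * (η i - θ i) * conv hα univ l (expo (l i)) x
        = c * ∑ m ∈ M, δ m * genDiff hα (u m) (v m) l x := by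
    simp only [hη, mul_assoc, ← mul_sum, sum_mul]
    rw [sum_comm]
    congr 1
    refine sum_congr rfl fun m _ => ?_
    simp [genDiff, conv_sub, ← mul_sum, sub_mul]
  have hanti : StrictAntiOn (fun τ => s * conv hα univ (fun i => (p τ i)⁻¹) unitStep x
      + t * conv hα univ (fun i => (p τ i)⁻¹) unitStep y) (Set.Icc 0 Real.pi) := by
    have hder (τ : ℝ) := ((hd x τ).const_mul s).fun_add ((hd y τ).const_mul t)
    refine strictAntiOn_of_deriv_neg (convex_Icc _ _)
      (fun τ _ => (hder τ).continuousAt.continuousWithinAt) fun τ hτ => ?_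
    rw [interior_Icc] at hτ
    rw [(hder τ).deriv, hsum (fun i => (p τ i)⁻¹),
      hsum (fun i => (p τ i)⁻¹)]
    have h1 : 0 < ∑ m ∈ M, δ m * (s * genDiff hα (u m) (v m) (fun i => (p τ i)⁻¹) x
        + t * genDiff hα (u m) (v m) (fun i => (p τ i)⁻¹) y) :=
      sum_pos (fun m hm => mul_pos (hδ m hm) (h _ (hθ _ (hr01 τ)).2 m hm)) hM
    have h2 : ∑ m ∈ M, δ m * (s * genDiff hα (u m) (v m) (fun i => (p τ i)⁻¹) x
        + t * genDiff hα (u m) (v m) (fun i => (p τ i)⁻¹) y)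
        = s * ∑ m ∈ M, δ m * genDiff hα (u m) (v m) (fun i => (p τ i)⁻¹) x
          + t * ∑ m ∈ M, δ m * genDiff hα (u m) (v m) (fun i => (p τ i)⁻¹) y := by
      rw [mul_sum, mul_sum, ← sum_add_distrib]
      exact sum_congr rfl fun m _ => by ring
    rw [h2] at h1
    have h3 := mul_pos (mul_pos (zero_lt_one.trans_le hα)
      (half_pos (Real.sin_pos_of_pos_of_lt_pi hτ.1 hτ.2))) h1
    linarith
  have key := hanti (Set.left_mem_Icc.2 Real.pi_pos.le) (Set.right_mem_Icc.2 Real.pi_pos.le)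
    Real.pi_pos
  have e0 : p 0 = θ := by funext i; simp [hp, hr]
  have e1 : p Real.pi = η := by funext i; simp [hp, hr]
  simp only [e0, e1] at key
  simp only [sub_apply]
  linarith

end path

end Volterra

/-! ### The perturbation and the theorem. -/

/-- The change of weights is a sum of transfers, one for each index other than `k` and `k + 1`:
below `k` the amount `δ m` comes from `k`, above `k + 1` it goes to `k + 1`. -/
theorem localPerturbation_sub {n k : ℕ} (θ δ : Fin n → ℝ) {a b : Fin n} (ha : (a : ℕ) + 1 = k)
    (hb : (b : ℕ) = k) (i : Fin n) :
    localPerturbation k θ δ i - θ i =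
      ∑ m ∈ univ.filter (fun i : Fin n => (i : ℕ) + 1 ≠ k ∧ (i : ℕ) + 1 ≠ k + 1),
        δ m * ((if (if (m : ℕ) + 1 < k then m else b) = i then 1 else 0)
          - (if (if (m : ℕ) + 1 < k then a else m) = i then 1 else 0)) := by
  have hsplit : univ.filter (fun i : Fin n => (i : ℕ) + 1 ≠ k ∧ (i : ℕ) + 1 ≠ k + 1)
      = univ.filter (fun j : Fin n => (j : ℕ) + 1 < k)
        ∪ univ.filter (fun j : Fin n => k + 1 < (j : ℕ) + 1) := by
    ext j
    simp only [mem_filter, mem_univ, true_and, mem_union]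
    omega
  have hdisj : Disjoint (univ.filter (fun j : Fin n => (j : ℕ) + 1 < k))
      (univ.filter (fun j : Fin n => k + 1 < (j : ℕ) + 1)) := by
    rw [disjoint_filter]
    omega
  have e1 : ∑ m ∈ univ.filter (fun j : Fin n => (j : ℕ) + 1 < k),
      δ m * ((if (if (m : ℕ) + 1 < k then m else b) = i then 1 else 0)
        - (if (if (m : ℕ) + 1 < k then a else m) = i then 1 else 0))
      = (if (i : ℕ) + 1 < k then δ i else 0)
        - (∑ m ∈ univ.filter (fun j : Fin n => (j : ℕ) + 1 < k), δ m) * if a = i then 1 else 0 := by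
    rw [sum_mul, sum_congr rfl fun m hm => by
      rw [if_pos (mem_filter.1 hm).2, if_pos (mem_filter.1 hm).2, mul_sub], sum_sub_distrib]
    simp
  have e2 : ∑ m ∈ univ.filter (fun j : Fin n => k + 1 < (j : ℕ) + 1),
      δ m * ((if (if (m : ℕ) + 1 < k then m else b) = i then 1 else 0)
        - (if (if (m : ℕ) + 1 < k then a else m) = i then 1 else 0))
      = (∑ m ∈ univ.filter (fun j : Fin n => k + 1 < (j : ℕ) + 1), δ m) * (if b = i then 1 else 0)
        - if k + 1 < (i : ℕ) + 1 then δ i else 0 := by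
    rw [sum_mul, sum_congr rfl fun m hm => by
      have := (mem_filter.1 hm).2
      rw [if_neg (by omega : ¬ (m : ℕ) + 1 < k), if_neg (by omega : ¬ (m : ℕ) + 1 < k), mul_sub],
      sum_sub_distrib]
    simp
  rw [hsplit, sum_union hdisj, e1, e2, localPerturbation]
  have hai : a = i ↔ (i : ℕ) + 1 = k := by rw [Fin.ext_iff]; omega
  have hbi : b = i ↔ (i : ℕ) + 1 = k + 1 := by rw [Fin.ext_iff]; omega
  simp only [hai, hbi]
  rcases lt_trichotomy ((i : ℕ) + 1) k with h | h | h
  · rw [if_pos h, if_pos h, if_neg (by omega), if_neg (by omega), if_neg (by omega)]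
    ring
  · rw [if_neg (by omega), if_pos h, if_neg (by omega), if_pos h, if_neg (by omega),
      if_neg (by omega)]
    ring
  · rcases eq_or_ne ((i : ℕ) + 1) (k + 1) with h' | h'
    · rw [if_neg (by omega), if_neg (by omega), if_pos h', if_neg (by omega), if_neg (by omega),
        if_pos h', if_neg (by omega)]
      ring
    · rw [if_neg (by omega), if_neg (by omega), if_neg h', if_neg (by omega), if_neg (by omega),
        if_neg h', if_pos (by omega)]
      ring

theorem abs_localPerturbation_sub_le {n k : ℕ} (hk : 0 < k) (hkn : k < n) (θ : Fin n → ℝ)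
    {δ : Fin n → ℝ} (hδ : ∀ i, 0 < δ i) (i : Fin n) :
    |localPerturbation k θ δ i - θ i| ≤
      ∑ m ∈ univ.filter (fun i : Fin n => (i : ℕ) + 1 ≠ k ∧ (i : ℕ) + 1 ≠ k + 1), δ m := by
  rw [localPerturbation_sub θ δ (a := ⟨k - 1, by omega⟩) (b := ⟨k, hkn⟩) (Nat.sub_add_cancel hk) rfl]
  refine (abs_sum_le_sum_abs _ _).trans (sum_le_sum fun m _ => ?_)
  rw [abs_mul, abs_of_pos (hδ m)]
  refine mul_le_of_le_one_right (hδ m).le ?_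
  split_ifs <;> norm_num

theorem mainTheorem7 (α : ℝ) (hα : 1 ≤ α) (n k : ℕ) (hk : 1 < k) (hkn : k + 1 < n)
    (θ : Fin n → ℝ) (hpos : ∀ i, 0 < θ i) (hmono : Monotone θ)
    (hlow : ∀ i j : Fin n, (i : ℕ) + 1 = k - 1 → (j : ℕ) + 1 = k → θ i < θ j)
    (hhigh : ∀ i j : Fin n, (i : ℕ) + 1 = k + 1 → (j : ℕ) + 1 = k + 2 → θ i < θ j) :
    ∃ ε : ℝ, 0 < ε ∧ ∀ δ : Fin n → ℝ, (∀ i, 0 < δ i) →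
      ∑ i ∈ univ.filter (fun i : Fin n => (i : ℕ) + 1 ≠ k ∧ (i : ℕ) + 1 ≠ k + 1), δ i < ε →
      CrossesExactlyOnceFromBelow
        (gammaSumCDF α (localPerturbation k θ δ)) (gammaSumCDF α θ) := by
  obtain ⟨a, ha⟩ : ∃ a : Fin n, (a : ℕ) + 1 = k := ⟨⟨k - 1, by omega⟩, by simp; omega⟩
  obtain ⟨b, hb⟩ : ∃ b : Fin n, (b : ℕ) = k := ⟨⟨k, by omega⟩, rfl⟩
  set M := univ.filter (fun i : Fin n => (i : ℕ) + 1 ≠ k ∧ (i : ℕ) + 1 ≠ k + 1) with hMdef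
  have hM : M.Nonempty := ⟨⟨0, by omega⟩, by
    simp only [hMdef, mem_filter, mem_univ, true_and]; omega⟩
  set u : Fin n → Fin n := fun m => if (m : ℕ) + 1 < k then m else b with hu
  set v : Fin n → Fin n := fun m => if (m : ℕ) + 1 < k then a else m with hv
  set l₀ : Fin n → ℝ := fun i => (θ i)⁻¹ with hl₀
  have hl (i : Fin n) : 0 < l₀ i := inv_pos.2 (hpos i)
  have hlt {i j : Fin n} (h : θ i < θ j) : l₀ j < l₀ i := (inv_lt_inv₀ (hpos j) (hpos i)).2 h
  -- Equality is allowed: `θ_k ≤ θ_{k+1}` is all that a pair from the two sides requires.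
  have hba : l₀ b ≤ l₀ a :=
    (inv_le_inv₀ (hpos b) (hpos a)).2 (hmono (Fin.le_def.2 (by omega)))
  have hlo (m : Fin n) (hm : (m : ℕ) + 1 < k) : l₀ a < l₀ m := hlt <|
    (hmono (Fin.le_def.2 (by simp; omega))).trans_lt (hlow ⟨k - 2, by omega⟩ a (by simp; omega) ha)
  have hhi (m : Fin n) (hm : m ∈ M) (hmk : ¬ (m : ℕ) + 1 < k) : l₀ m < l₀ b := hlt <| by
    have := (mem_filter.1 hm).2
    exact (hhigh b ⟨k + 1, hkn⟩ (by omega) rfl).trans_le (hmono (Fin.le_def.2 (by simp; omega)))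
  have huv : ∀ m ∈ M, l₀ (v m) < l₀ (u m) := fun m hm => by
    by_cases h : (m : ℕ) + 1 < k
    · simp only [hu, hv, if_pos h]; exact hlo m h
    · simp only [hu, hv, if_neg h]; exact hhi m hm h
  obtain ⟨A, hA, hApos⟩ := Volterra.eventually_genDiff_pos hα hl huv
  obtain ⟨B, hBneg⟩ := Volterra.eventually_genDiff_neg hα hl huv
  obtain ⟨N, hN, hcross⟩ := Volterra.exists_nhds_forall_average (M := M)
    (fun m => Volterra.jointlyContinuous_genDiff hα (u m) (v m))
    (fun m => Volterra.jointlyContinuous_genDiffDeriv hα (u m) (v m))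
    (fun m => Volterra.hasDerivAt_genDiff hα (u m) (v m)) (p₀ := l₀)
    (fun z hz m hm m' hm' c c' hc hc' hcc => by
      -- Two transfers below `k` share the index `k`, two above share `k + 1`, and a mixed pair is
      -- the cross case, up to order.
      by_cases h : (m : ℕ) + 1 < k <;> by_cases h' : (m' : ℕ) + 1 < k <;>
        simp only [hu, hv, if_pos, h, h', if_false]
      · exact Volterra.genDiffDeriv_pair_left hα hl (hlo m h) (hlo m' h') hc hc' hcc hz
      · exact Volterra.genDiffDeriv_pair_cross hα hl (hlo m h) (hhi m' hm' h') hba hc hc' hcc hz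
      · intro h0
        rw [add_comm] at h0 hcc ⊢
        exact Volterra.genDiffDeriv_pair_cross hα hl (hlo m' h') (hhi m hm h) hba hc' hc hcc hz h0
      · exact Volterra.genDiffDeriv_pair_right hα hl (hhi m hm h) (hhi m' hm' h') hc hc' hcc hz)
    hA hApos hBneg
  have hev : ∀ᶠ p : Fin n → ℝ in nhds θ, (∀ i, 0 < p i) ∧ (fun i => (p i)⁻¹) ∈ N := by
    refine Filter.Eventually.and (Filter.eventually_all.2 fun i =>
      continuousAt_const.eventually_lt (continuous_apply i).continuousAt (hpos i)) ?_
    have : ContinuousAt (fun p : Fin n → ℝ => fun i => (p i)⁻¹) θ :=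
      continuousAt_pi.2 fun i => (continuous_apply i).continuousAt.inv₀ (hpos i).ne'
    exact this.eventually_mem hN
  -- The distance is the sup distance, and every coordinate moves by at most the sum of the `δ m`,
  -- so the radius of the ball serves as the bound on that sum.
  obtain ⟨ε, hε, hball⟩ := Metric.eventually_nhds_iff.1 hev
  refine ⟨ε, hε, fun δ hδ hδε => ?_⟩
  set η := localPerturbation k θ δ with hη
  have hseg : ∀ r ∈ Set.Icc (0 : ℝ) 1, (∀ i, 0 < θ i + r * (η i - θ i)) ∧
      (fun i => (θ i + r * (η i - θ i))⁻¹) ∈ N := fun r hr => by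
    refine hball (y := fun i => θ i + r * (η i - θ i)) ((dist_pi_lt_iff hε).2 fun i => ?_)
    rw [Real.dist_eq, add_sub_cancel_left, abs_mul, abs_of_nonneg hr.1]
    exact ((mul_le_of_le_one_left (abs_nonneg _) hr.2).trans
      (abs_localPerturbation_sub_le (by omega) (by omega) θ hδ i)).trans_lt hδε
  have hηpos (i : Fin n) : 0 < η i := by
    have := (hseg 1 ⟨zero_le_one, le_rfl⟩).1 i
    linarith
  obtain ⟨x₀, hx₀, h1, h2⟩ := hcross
    (Volterra.conv hα univ (fun i => (θ i)⁻¹) Volterra.unitStep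
      - Volterra.conv hα univ (fun i => (η i)⁻¹) Volterra.unitStep : Volterra)
    (Volterra.continuous _) fun x y s t _ _ h =>
      Volterra.conv_unitStep_sub_pos hα hM (fun m _ => hδ m)
        (localPerturbation_sub θ δ ha hb) hseg h
  refine ⟨x₀, hx₀, fun x hx hxx => ?_, fun x hx => ?_⟩
  · have := h1 x hx hxx
    rw [Volterra.sub_apply] at this
    rw [Volterra.gammaSumCDF_eq hα η hηpos hx.le, Volterra.gammaSumCDF_eq hα θ hpos hx.le]
    linarith
  · have := h2 x hx
    rw [Volterra.sub_apply] at this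
    rw [Volterra.gammaSumCDF_eq hα η hηpos (hx₀.trans hx).le,
      Volterra.gammaSumCDF_eq hα θ hpos (hx₀.trans hx).le]
    linarith
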